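/- **Setting.** Let $\mathcal C$ be a finite set of contexts and $\mathcal D=\bigsqcup_{c\in\mathcal C}\mathcal D_c$ a finite set of designs. Let $1\le m_c<|\mathcal D_c|$ for every $c\in\mathcal C$. Let $\Theta\subseteq\mathbb R\times\mathbb R^k$ be a parameter set with elements $\theta=(\mu,\eta)$, and let $\{p(\cdot\mid\theta):\theta\in\Theta\}$ be probability densities on $\mathbb R$ with respect to a base measure $\nu$ such that: 1. $\Theta$ is compact and its boundary is Lebesgue-null; 2. $\theta\mapsto p(y\mid\theta)$ is continuous on $\Theta$ for every $y$; 3. for $\theta\ne\theta'$ in $\Theta$, the set $\{y: p(y\mid\theta)\neq p(y\mid\theta')\}$ has positive $\nu$-measure; 4. the log-likelihood ratios $\ln\{p(y\mid\theta')/p(y\mid\theta'')\}$, $\theta',\theta''\in\Theta$, form a universal Glivenko–Cantelli class: for every $\theta\in\Theta$, if $Y,Y^{(1)},Y^{(2)},\dots$ are i.i.d. with density $p(\cdot\mid\theta)$, then almost surely all $p(Y\mid\theta')$, $\theta'\in\Theta$, are positive, every log-likelihood ratio is integrable, and $$\sup_{\theta',\theta''\in\Theta}\Big|\frac1T\sum_{t=1}^T\ln\frac{p(Y^{(t)}\mid\theta')}{p(Y^{(t)}\mid\theta'')}-\mathbb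 E\ln\frac{p(Y\mid\theta')}{p(Y\mid\theta'')}\Big|\to0\quad\text{almost surely}.$$ Fix a true parameter $\boldsymbol\theta^*=(\theta^*_d)_{d\in\mathcal D}$ with every $\theta_d^*$ in the interior of $\Theta$. Let $\boldsymbol Y^{(t)}=(Y^{(t)}_d)_{d\in\mathcal D}$, $t\ge1$, be independent replications of a vector whose coordinates are independent with densities $p(\cdot\mid\theta^*_d)$. At step $t$ a design $D_t\in\mathcal D$ (and so the context $C_t$ with $D_t\in\mathcal D_{C_t}$) is chosen and $Y^{(t)}_{D_t}$ is observed. Let $\mathcal E_{t}=\sigma(D_1,Y^{(1)}_{D_1},\dots,D_{t},Y^{(t)}_{D_{t}})$, and let $\Pi_t$ be the posterior distribution on $\Theta^{\mathcal D}$ for the uniform prior, i.e. the probability measure with Lebesgue density proportional to $\prod_{s\le t}p(Y^{(s)}_{D_s}\mid\theta_{D_s})$. **TTTS-C** with hyperparameters $\gamma_t(c)\in(0,1)$, where $\gamma_t(c)$ is $\mathcal E_{t-1}$-measurable (known before step $t$), chooses $D_t$ as follows, by randomization that, given the observed information $\mathcal E_{t-1}$, depends on nothing else, and such that $\boldsymbol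 Y^{(t)}$ is independent of $\boldsymbol Y^{(1)},\dots,\boldsymbol Y^{(t-1)},D_1,\dots,D_t$. Draw $\hat{\boldsymbol\theta}_1\sim\Pi_{t-1}$, and for each $c$ let $\hat{\mathcal P}_{c,1}$ be the set of the $m_c$ designs of $\mathcal D_c$ with the largest sampled $\mu_d$ (ties broken by a fixed order). Re-sample $\hat{\boldsymbol\theta}_2\sim\Pi_{t-1}$ independently, forming $\hat{\mathcal P}_{c,2}$ in the same way, until $\Delta_t=\{c:\hat{\mathcal P}_{c,1}\ne\hat{\mathcal P}_{c,2}\}$ is non-empty. Choose $C_t$ uniformly from $\Delta_t$. With probability $\gamma_t(C_t)$ choose $D_t$ uniformly from $\hat{\mathcal P}_{C_t,1}\setminus\hat{\mathcal P}_{C_t,2}$; otherwise choose $D_t$ uniformly from $\hat{\mathcal P}_{C_t,2}\setminus\hat{\mathcal P}_{C_t,1}$. **Theorem (consistency).** Almost surely, for every $c\in\mathcal C$ and every $d\in\mathcal D_c$, $$\sum_{t=1}^T\mathbf 1\{D_t=d\}\longrightarrow\infty\quad\text{as }T\to\infty .$$ In particular this holds for every constant hyperparameter $\gamma\in(0,1)^{\mathcal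 C}$, and for $m_c=1$ (best-design selection, $|\mathcal D_c|\ge2$). -/

import Mathlib

open MeasureTheory ProbabilityTheory Filter

namespace TTTSC

/-- Parameter `θ = (μ, η)` of one design: parameter of interest `μ ∈ ℝ`, nuisance `η ∈ ℝᵏ`. -/
abbrev Param (k : ℕ) : Type := ℝ × (Fin k → ℝ)

noncomputable section

/-- The sampling distribution with density `p(· | θ)` with respect to the base measure `ν`. -/
def sampleLaw {k : ℕ} (ν : Measure ℝ) (p : Param k → ℝ → ℝ) (θ : Param k) : Measure ℝ :=
  ν.withDensity fun y => ENNReal.ofReal (p θ y)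

/-- The log-likelihood ratio `ln (p(y | θ') / p(y | θ''))`. -/
def logRatio {k : ℕ} (p : Param k → ℝ → ℝ) (θ' θ'' : Param k) (y : ℝ) : ℝ :=
  Real.log (p θ' y / p θ'' y)

/-- `{p(· | θ) : θ ∈ Θ}` is a parametric family of probability densities with respect to `ν`
that satisfies the regularity conditions of the model. -/
structure RegularFamily {k : ℕ} (ν : Measure ℝ) (Θ : Set (Param k)) (p : Param k → ℝ → ℝ) :
    Prop where
  measurable : ∀ θ ∈ Θ, Measurable (p θ)
  nonneg : ∀ θ ∈ Θ, ∀ y, 0 ≤ p θ y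
  lintegral_eq_one : ∀ θ ∈ Θ, ∫⁻ y, ENNReal.ofReal (p θ y) ∂ν = 1
  /-- The parameter space is compact. -/
  isCompact : IsCompact Θ
  /-- The boundary of the parameter space is Lebesgue-null. -/
  volume_frontier : volume (frontier Θ) = 0
  /-- Pointwise continuity in the parameter. -/
  continuousOn : ∀ y, ContinuousOn (fun θ => p θ y) Θ
  /-- Identifiability: the densities of distinct parameters differ on a set of positive measure. -/
  identifiable : ∀ θ ∈ Θ, ∀ θ' ∈ Θ, θ ≠ θ' → 0 < ν {y | p θ y ≠ p θ' y}
  /-- The log-likelihood ratios are real-valued (the densities do not vanish), up to sets that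
  carry no mass under any member of the family. -/
  pos : ∀ θ ∈ Θ, ∀ᵐ y ∂(sampleLaw ν p θ), ∀ θ' ∈ Θ, 0 < p θ' y
  /-- The log-likelihood ratios have finite expectations. -/
  integrable : ∀ θ ∈ Θ, ∀ θ' ∈ Θ, ∀ θ'' ∈ Θ, Integrable (logRatio p θ' θ'') (sampleLaw ν p θ)
  /-- Universal Glivenko-Cantelli property: under i.i.d. sampling from any member of the family,
  almost surely the empirical means of all log-likelihood ratios converge uniformly. -/
  glivenkoCantelli : ∀ θ ∈ Θ, ∀ᵐ y ∂(Measure.infinitePi fun _ : ℕ => sampleLaw ν p θ),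
    TendstoUniformlyOn
      (fun (T : ℕ) (q : Param k × Param k) =>
        (∑ t ∈ Finset.range T, logRatio p q.1 q.2 (y t)) / (T : ℝ))
      (fun q => ∫ x, logRatio p q.1 q.2 x ∂(sampleLaw ν p θ))
      atTop (Θ ×ˢ Θ)

/-- The likelihood `∏_{s < t} p(y_s | θ_{d_s})` of the first `t` observations, where at step `s`
design `d_s = D s` was simulated with output `y_s = z s`. -/
def likelihood {k : ℕ} {𝒟 : Type*} (p : Param k → ℝ → ℝ) (D : ℕ → 𝒟) (z : ℕ → ℝ) (t : ℕ)
    (θ : 𝒟 → Param k) : ℝ :=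
  ∏ s ∈ Finset.range t, p (θ (D s)) (z s)

/-- The posterior distribution on `Θ^𝒟` after the first `t` observations, for the uniform prior:
its Lebesgue density on `Θ^𝒟` is the likelihood, normalized. -/
def posterior {k : ℕ} {𝒟 : Type*} [Fintype 𝒟] (Θ : Set (Param k)) (p : Param k → ℝ → ℝ)
    (D : ℕ → 𝒟) (z : ℕ → ℝ) (t : ℕ) : Measure (𝒟 → Param k) :=
  (∫⁻ θ in Set.univ.pi fun _ => Θ, ENNReal.ofReal (likelihood p D z t θ))⁻¹ •
    (volume.restrict (Set.univ.pi fun _ => Θ)).withDensity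
      fun θ => ENNReal.ofReal (likelihood p D z t θ)

open Classical in
/-- The `m c` designs of context `c` (those with `ctx d = c`) with the largest `μ_d`; ties in `μ`
are broken in favor of the smaller design. -/
def topSet {k : ℕ} {𝒞 𝒟 : Type*} [Fintype 𝒟] [LinearOrder 𝒟] (ctx : 𝒟 → 𝒞) (m : 𝒞 → ℕ)
    (θ : 𝒟 → Param k) (c : 𝒞) : Finset 𝒟 :=
  {d | ctx d = c ∧
    (Finset.univ.filter fun d' => ctx d' = c ∧
      ((θ d).1 < (θ d').1 ∨ ((θ d').1 = (θ d).1 ∧ d' < d))).card < m c}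

open Classical in
/-- The probability that design `d` is simulated, given the top sets `P₁ c` and `P₂ c` of the first
and of the second posterior sample. The context `C` is uniform on the set of contexts with
`P₁ c ≠ P₂ c`, the candidates are uniform on `P₁ C \ P₂ C` and on `P₂ C \ P₁ C`, and the first
candidate is simulated with probability `γ C`, the second one with probability `1 - γ C`. -/
def allocProb {𝒞 𝒟 : Type*} [Fintype 𝒞] [LinearOrder 𝒟] (ctx : 𝒟 → 𝒞) (γ : 𝒞 → ℝ)
    (P₁ P₂ : 𝒞 → Finset 𝒟) (d : 𝒟) : ℝ :=
  ((Finset.univ.filter fun c => P₁ c ≠ P₂ c).card : ℝ)⁻¹ *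
    ((if d ∈ P₁ (ctx d) \ P₂ (ctx d) then
        γ (ctx d) * ((P₁ (ctx d) \ P₂ (ctx d)).card : ℝ)⁻¹ else 0) +
      (if d ∈ P₂ (ctx d) \ P₁ (ctx d) then
        (1 - γ (ctx d)) * ((P₂ (ctx d) \ P₁ (ctx d)).card : ℝ)⁻¹ else 0))

/-- The index of the first re-sample `s n` whose top sets are not, in every context, those of the
first sample `θ₁`. -/
def stopIndex {k : ℕ} {𝒞 𝒟 : Type*} [Fintype 𝒟] [LinearOrder 𝒟] (ctx : 𝒟 → 𝒞) (m : 𝒞 → ℕ)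
    (θ₁ : 𝒟 → Param k) (s : ℕ → 𝒟 → Param k) : ℕ :=
  sInf {n | topSet ctx m (s n) ≠ topSet ctx m θ₁}

/-- The probability that one step of the top-two algorithm with posterior `post` and hyperparameter
`γ` simulates design `d`: draw `θ₁` from `post`, then re-sample `s 0, s 1, …` independently from
`post` until the top sets differ from those of `θ₁`, then allocate. -/
def topTwoPolicy {k : ℕ} {𝒞 𝒟 : Type*} [Fintype 𝒞] [Fintype 𝒟] [LinearOrder 𝒟] (ctx : 𝒟 → 𝒞)
    (m : 𝒞 → ℕ) (post : Measure (𝒟 → Param k)) (γ : 𝒞 → ℝ) (d : 𝒟) : ℝ :=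
  (∫⁻ θ₁, ∫⁻ s, ENNReal.ofReal
      (allocProb ctx γ (topSet ctx m θ₁) (topSet ctx m (s (stopIndex ctx m θ₁ s))) d)
    ∂(Measure.infinitePi fun _ : ℕ => post) ∂post).toReal

/-- The `σ`-field generated by the information `(D s, Y s (D s))`, `s < t`, that has been observed
before step `t` (the context simulated at step `s` is a function of `D s`). -/
@[reducible] def observed {Ω 𝒟 : Type*} [MeasurableSpace 𝒟] (D : ℕ → Ω → 𝒟) (Y : ℕ → Ω → 𝒟 → ℝ) (t : ℕ) :
    MeasurableSpace Ω :=
  MeasurableSpace.comap (fun ω (s : Fin t) => (D s ω, Y s ω (D s ω))) inferInstance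

/-- The `σ`-field generated by all outputs `Y s`, `s < t`, and all choices `D s`, `s ≤ t`. -/
@[reducible] def beforeOutput {Ω 𝒟 : Type*} [MeasurableSpace 𝒟] (D : ℕ → Ω → 𝒟) (Y : ℕ → Ω → 𝒟 → ℝ) (t : ℕ) :
    MeasurableSpace Ω :=
  MeasurableSpace.comap (fun ω (s : Fin t) => Y s ω) inferInstance ⊔
    MeasurableSpace.comap (fun ω (s : Fin (t + 1)) => D s ω) inferInstance

/-- `D 0, D 1, …` are the designs simulated by the algorithm, with hyperparameter `γ t` at step
`t`, when the outputs `Y t` are independent replications under the true parameter `θstar`. -/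
structure IsTopTwoRun {k : ℕ} {𝒞 𝒟 Ω : Type*} [Fintype 𝒞] [Fintype 𝒟] [LinearOrder 𝒟]
    [MeasurableSpace 𝒟] [MeasurableSpace Ω] (prob : Measure Ω)
    (ν : Measure ℝ) (Θ : Set (Param k)) (p : Param k → ℝ → ℝ) (θstar : 𝒟 → Param k)
    (ctx : 𝒟 → 𝒞) (m : 𝒞 → ℕ) (γ : ℕ → Ω → 𝒞 → ℝ) (D : ℕ → Ω → 𝒟) (Y : ℕ → Ω → 𝒟 → ℝ) :
    Prop where
  measurable_design : ∀ t, Measurable (D t)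
  measurable_output : ∀ t, Measurable (Y t)
  /-- At every step the outputs of the designs are independent, that of `d` having law
  `p(· | θstar d) dν`. -/
  map_output : ∀ t, prob.map (Y t) = Measure.pi fun d => sampleLaw ν p (θstar d)
  /-- The replications are independent of each other, and the choice of the design to simulate
  does not anticipate its output. -/
  indep_output : ∀ t, Indep (MeasurableSpace.comap (Y t) inferInstance) (beforeOutput D Y t) prob
  /-- The hyperparameter takes values in `(0,1)` and is known before the step in which it is
  used. -/
  gamma_mem : ∀ t ω c, γ t ω c ∈ Set.Ioo (0 : ℝ) 1
  gamma_adapted : ∀ t c, Measurable[observed D Y t] fun ω => γ t ω c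
  /-- Given the observed information, the next design is chosen by one step of the algorithm run
  with the current posterior. -/
  condProb_design : ∀ t d, prob[({ω | D t ω = d}).indicator (fun _ => (1 : ℝ)) | observed D Y t]
    =ᵐ[prob] fun ω => topTwoPolicy ctx m
      (posterior Θ p (fun s => D s ω) (fun s => Y s ω (D s ω)) t) (γ t ω) d

end

end TTTSC

/-!
The argument is by contradiction, for one design `d` and one typical outcome. Suppose that `d` is
simulated only finitely often. Then the likelihood of its parameter is eventually frozen, so the
posterior keeps a fixed positive mass on every open subset of the interior of `Θ` for this
parameter. For every other design, however often it is simulated, each neighborhood of the true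
parameter keeps a fixed positive fraction of the posterior mass (`TypicalSample.exists_mass`). True
parameters are interior points, so there are levels `a` and `b` above and below all true `μ` that
the parameter `μ_d` crosses inside `Θ`. As the posterior is a product over designs, both "`μ_d` is
the largest `μ`" and "`μ_d` is the smallest `μ`" have posterior probability bounded away from zero
(`exists_le_posterior_pi`). In the first case `d` belongs to the top set of its context, in the
second it does not. The two independent posterior samples fall into these two events, in either
order, with a probability bounded below. In one order `d` is simulated with weight `γ`, in the other
with weight `1 - γ`, so the resulting bound on the selection probability does not depend on `γ`
(`le_topTwoPolicy`), and no control on how the adaptive hyperparameter approaches `0` or `1` is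
needed. By Lévy's conditional Borel-Cantelli lemma `d` is then selected infinitely often, a
contradiction.

Two ingredients make this work. The first is a deterministic posterior estimate along typical
samples. Expected log-likelihood ratios are continuous, being uniform limits of continuous empirical
means, and by Gibbs' inequality (`RegularFamily.integral_logRatio_neg`) and compactness they are
bounded away from zero outside a neighborhood `U` of the true parameter. Uniform convergence then
makes the likelihood outside `U` eventually smaller than everywhere on a smaller neighborhood `W`,
and comparing integrals over `Θ \ U` and `W` bounds the posterior mass of `U` from below.

The second is optional skipping (`map_fill_eq_infinitePi`). The Glivenko-Cantelli property concerns
i.i.d. samples, but the outputs of a design are observed at random times that depend on the past.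
They still form an i.i.d. sequence once they are continued by independent copies when there are only
finitely many of them. This is shown on finite boxes by a martingale argument: the conditional
probability of a box, given the outputs observed so far, has constant expectation.
-/

namespace TTTSC

variable {k : ℕ} {ν : Measure ℝ} {Θ : Set (Param k)} {p : Param k → ℝ → ℝ}

/-! ### Information inequality -/

namespace RegularFamily

lemma isProbabilityMeasure (hfam : RegularFamily ν Θ p) {θ : Param k} (hθ : θ ∈ Θ) :
    IsProbabilityMeasure (sampleLaw ν p θ) :=
  ⟨by rw [sampleLaw, withDensity_apply _ MeasurableSet.univ, Measure.restrict_univ,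
    hfam.lintegral_eq_one θ hθ]⟩

lemma lintegral_ratio_le_one (hfam : RegularFamily ν Θ p) {θ θ' : Param k} (hθ : θ ∈ Θ)
    (hθ' : θ' ∈ Θ) :
    ∫⁻ y, ENNReal.ofReal (p θ' y / p θ y) ∂(sampleLaw ν p θ) ≤ 1 := by
  have hm := hfam.measurable θ hθ
  have hm' := hfam.measurable θ' hθ'
  rw [sampleLaw, lintegral_withDensity_eq_lintegral_mul _ hm.ennreal_ofReal
    (show Measurable fun y => ENNReal.ofReal (p θ' y / p θ y) from (hm'.div hm).ennreal_ofReal),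
    ← hfam.lintegral_eq_one θ' hθ']
  refine lintegral_mono fun y => ?_
  rw [Pi.mul_apply, ← ENNReal.ofReal_mul (hfam.nonneg θ hθ y)]
  refine ENNReal.ofReal_le_ofReal ?_
  rcases eq_or_ne (p θ y) 0 with h | h
  · simpa [h] using hfam.nonneg θ' hθ' y
  · exact (mul_div_cancel₀ _ h).le

/-- Gibbs' inequality: the expected log-likelihood ratio of a wrong parameter against the true one
is negative. Strictness comes from identifiability, through the equality case of
`log x ≤ x - 1`. -/
lemma integral_logRatio_neg (hfam : RegularFamily ν Θ p) {θ θ' : Param k} (hθ : θ ∈ Θ)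
    (hθ' : θ' ∈ Θ) (hne : θ' ≠ θ) : ∫ y, logRatio p θ' θ y ∂(sampleLaw ν p θ) < 0 := by
  have := hfam.isProbabilityMeasure hθ
  have hm := hfam.measurable θ hθ
  have hm' := hfam.measurable θ' hθ'
  have hpos := hfam.pos θ hθ
  have hratio : ∀ᵐ y ∂(sampleLaw ν p θ), 0 < p θ' y / p θ y :=
    hpos.mono fun y hy => div_pos (hy θ' hθ') (hy θ hθ)
  have hle := hfam.lintegral_ratio_le_one hθ hθ'
  have hint : Integrable (fun y => p θ' y / p θ y) (sampleLaw ν p θ) := by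
    refine ⟨(hm'.div hm).aestronglyMeasurable, ?_⟩
    rw [hasFiniteIntegral_iff_ofReal (hratio.mono fun _ h => h.le)]
    exact hle.trans_lt ENNReal.one_lt_top
  have hint_le : ∫ y, p θ' y / p θ y ∂(sampleLaw ν p θ) ≤ 1 := by
    rw [integral_eq_lintegral_of_nonneg_ae (hratio.mono fun _ h => h.le)
      (hm'.div hm).aestronglyMeasurable]
    exact ENNReal.toReal_mono ENNReal.one_ne_top hle
  by_contra! hcon
  have hlog := hfam.integrable θ hθ θ' hθ' θ hθ
  have hdef : 0 ≤ᵐ[sampleLaw ν p θ] fun y => p θ' y / p θ y - 1 - logRatio p θ' θ y :=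
    hratio.mono fun y hy => sub_nonneg.2 (Real.log_le_sub_one_of_pos hy)
  have hzero : ∫ y, (p θ' y / p θ y - 1 - logRatio p θ' θ y) ∂(sampleLaw ν p θ) = 0 := by
    refine le_antisymm ?_ (integral_nonneg_of_ae hdef)
    rw [integral_sub (f := fun y => p θ' y / p θ y - 1) (hint.sub (integrable_const _)) hlog,
      integral_sub hint (integrable_const _)]
    simp only [integral_const, probReal_univ, one_smul]
    linarith
  rw [integral_eq_zero_iff_of_nonneg_ae hdef ((hint.sub (integrable_const _)).sub hlog)] at hzero
  -- Equality in `log x ≤ x - 1` forces the densities to agree where `p θ` is positive. As both have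
  -- total mass one, they then agree `ν`-almost everywhere.
  have heq : ∀ᵐ y ∂(sampleLaw ν p θ), p θ' y = p θ y := by
    filter_upwards [hzero, hpos] with y hy hy'
    have h1 := hy' θ hθ
    by_contra hne'
    have := Real.log_lt_sub_one_of_pos (div_pos (hy' θ' hθ') h1)
      (fun h => hne' ((div_eq_one_iff_eq h1.ne').1 h))
    simp only [Pi.zero_apply, logRatio] at hy
    linarith
  rw [sampleLaw, ae_withDensity_iff hm.ennreal_ofReal] at heq
  have hae : (fun y => ENNReal.ofReal (p θ y)) =ᵐ[ν] fun y => ENNReal.ofReal (p θ' y) := by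
    refine ae_eq_of_ae_le_of_lintegral_le ?_ ?_ hm'.ennreal_ofReal.aemeasurable ?_
    · filter_upwards [heq] with y hy
      rcases eq_or_ne (ENNReal.ofReal (p θ y)) 0 with h | h
      · rw [h]; exact zero_le
      · rw [hy h]
    · rw [hfam.lintegral_eq_one θ hθ]; exact ENNReal.one_ne_top
    · rw [hfam.lintegral_eq_one θ hθ, hfam.lintegral_eq_one θ' hθ']
  refine (hfam.identifiable θ' hθ' θ hθ hne).ne' ?_
  have : ∀ᵐ y ∂ν, p θ' y = p θ y := hae.mono fun y hy =>
    ((ENNReal.ofReal_eq_ofReal_iff (hfam.nonneg θ hθ y) (hfam.nonneg θ' hθ' y)).1 hy).symm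
  exact ae_iff.1 this

/-- Expected log-likelihood ratios form a cocycle, so they are differences of expected ratios
against the true parameter. -/
lemma integral_logRatio_eq_sub (hfam : RegularFamily ν Θ p) {θ θ₁ θ₂ : Param k} (hθ : θ ∈ Θ)
    (h₁ : θ₁ ∈ Θ) (h₂ : θ₂ ∈ Θ) :
    ∫ y, logRatio p θ₁ θ₂ y ∂(sampleLaw ν p θ) =
      ∫ y, logRatio p θ₁ θ y ∂(sampleLaw ν p θ) - ∫ y, logRatio p θ₂ θ y ∂(sampleLaw ν p θ) := by
  rw [← integral_sub (hfam.integrable θ hθ θ₁ h₁ θ hθ) (hfam.integrable θ hθ θ₂ h₂ θ hθ)]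
  refine integral_congr_ae ?_
  filter_upwards [hfam.pos θ hθ] with y hy
  simp only [logRatio]
  rw [Real.log_div (hy _ h₁).ne' (hy _ h₂).ne', Real.log_div (hy _ h₁).ne' (hy _ hθ).ne',
    Real.log_div (hy _ h₂).ne' (hy _ hθ).ne']
  ring

end RegularFamily

/-! ### Posterior mass of one design along a typical sample -/

/-- The likelihood of the first `n` entries of the sample `z` of a single design. -/
def seqLik (p : Param k → ℝ → ℝ) (z : ℕ → ℝ) (n : ℕ) (θ : Param k) : ℝ :=
  ∏ j ∈ Finset.range n, p θ (z j)

/-- A sample path of outputs of a design with parameter `θ` that is typical: all densities are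
positive along it, and the empirical log-likelihood ratios converge uniformly to their
expectations. -/
structure TypicalSample (ν : Measure ℝ) (Θ : Set (Param k)) (p : Param k → ℝ → ℝ) (θ : Param k)
    (z : ℕ → ℝ) : Prop where
  pos : ∀ n, ∀ θ' ∈ Θ, 0 < p θ' (z n)
  uniform : TendstoUniformlyOn
      (fun (T : ℕ) (q : Param k × Param k) =>
        (∑ t ∈ Finset.range T, logRatio p q.1 q.2 (z t)) / (T : ℝ))
      (fun q => ∫ x, logRatio p q.1 q.2 x ∂(sampleLaw ν p θ))
      atTop (Θ ×ˢ Θ)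

lemma RegularFamily.continuousOn_seqLik (hfam : RegularFamily ν Θ p) (z : ℕ → ℝ) (n : ℕ) :
    ContinuousOn (seqLik p z n) Θ :=
  continuousOn_finsetProd _ fun j _ => hfam.continuousOn (z j)

lemma RegularFamily.integrableOn_seqLik (hfam : RegularFamily ν Θ p) (z : ℕ → ℝ) (n : ℕ) :
    IntegrableOn (seqLik p z n) Θ :=
  (hfam.continuousOn_seqLik z n).integrableOn_compact hfam.isCompact

lemma RegularFamily.seqLik_nonneg (hfam : RegularFamily ν Θ p) (z : ℕ → ℝ) (n : ℕ) {θ : Param k}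
    (hθ : θ ∈ Θ) : 0 ≤ seqLik p z n θ :=
  Finset.prod_nonneg fun _ _ => hfam.nonneg θ hθ _

namespace TypicalSample

variable {θ : Param k} {z : ℕ → ℝ}

lemma seqLik_pos (hz : TypicalSample ν Θ p θ z) (n : ℕ) {θ' : Param k} (hθ' : θ' ∈ Θ) :
    0 < seqLik p z n θ' :=
  Finset.prod_pos fun _ _ => hz.pos _ θ' hθ'

lemma log_seqLik_sub (hz : TypicalSample ν Θ p θ z) (n : ℕ) {θ₁ θ₂ : Param k} (h₁ : θ₁ ∈ Θ)
    (h₂ : θ₂ ∈ Θ) :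
    ∑ t ∈ Finset.range n, logRatio p θ₁ θ₂ (z t) =
      Real.log (seqLik p z n θ₁) - Real.log (seqLik p z n θ₂) := by
  rw [seqLik, seqLik, Real.log_prod (fun j _ => (hz.pos j _ h₁).ne'),
    Real.log_prod (fun j _ => (hz.pos j _ h₂).ne'), ← Finset.sum_sub_distrib]
  exact Finset.sum_congr rfl fun j _ => Real.log_div (hz.pos j _ h₁).ne' (hz.pos j _ h₂).ne'

/-- Expected log-likelihood ratios are continuous in the parameters, as a uniform limit of
continuous empirical means. -/
lemma continuousOn_integral (hfam : RegularFamily ν Θ p) (hz : TypicalSample ν Θ p θ z) :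
    ContinuousOn (fun q : Param k × Param k => ∫ x, logRatio p q.1 q.2 x ∂(sampleLaw ν p θ))
      (Θ ×ˢ Θ) := by
  refine hz.uniform.continuousOn (Frequently.of_forall fun T => ?_)
  refine ContinuousOn.div_const (continuousOn_finsetSum _ fun t _ => ?_) _
  have h1 : ContinuousOn (fun q : Param k × Param k => p q.1 (z t)) (Θ ×ˢ Θ) :=
    (hfam.continuousOn (z t)).comp continuousOn_fst fun q hq => hq.1
  have h2 : ContinuousOn (fun q : Param k × Param k => p q.2 (z t)) (Θ ×ˢ Θ) :=
    (hfam.continuousOn (z t)).comp continuousOn_snd fun q hq => hq.2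
  exact (h1.div h2 fun q hq => (hz.pos t _ hq.2).ne').log
    fun q hq => (div_pos (hz.pos t _ hq.1) (hz.pos t _ hq.2)).ne'

/-- Outside an open neighborhood `U` of the true parameter the likelihood is eventually dominated,
uniformly, by the likelihood on some smaller neighborhood `W`. -/
lemma exists_open_seqLik_le (hfam : RegularFamily ν Θ p) (hz : TypicalSample ν Θ p θ z)
    (hθ : θ ∈ interior Θ) {U : Set (Param k)} (hU : IsOpen U) (hθU : θ ∈ U) :
    ∃ W : Set (Param k), IsOpen W ∧ W.Nonempty ∧ W ⊆ Θ ∩ U ∧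
      ∀ᶠ n in atTop, ∀ θ₁ ∈ Θ \ U, ∀ θ₂ ∈ W, seqLik p z n θ₁ ≤ seqLik p z n θ₂ := by
  have hθΘ := interior_subset hθ
  rcases (Θ \ U).eq_empty_or_nonempty with hemp | hne
  · refine ⟨interior Θ ∩ U, isOpen_interior.inter hU, ⟨θ, hθ, hθU⟩,
      Set.inter_subset_inter_left _ interior_subset, Eventually.of_forall fun n θ₁ h₁ => ?_⟩
    rw [hemp] at h₁
    exact h₁.elim
  -- `h` is minus the Kullback-Leibler divergence from the true parameter, maximal (and zero) at it.
  set h : Param k → ℝ := fun θ' => ∫ x, logRatio p θ' θ x ∂(sampleLaw ν p θ) with hh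
  have hcont : ContinuousOn h Θ :=
    (hz.continuousOn_integral hfam).comp (f := fun θ' => (θ', θ)) (by fun_prop)
      fun θ' hθ' => ⟨hθ', hθΘ⟩
  obtain ⟨θm, hθm, hmax⟩ :=
    (hfam.isCompact.diff hU).exists_isMaxOn hne (hcont.mono Set.sdiff_subset)
  have hneg : h θm < 0 := hfam.integral_logRatio_neg hθΘ hθm.1 fun he => hθm.2 (he ▸ hθU)
  have hself : h θ = 0 := by
    have h0 := hfam.integral_logRatio_eq_sub hθΘ hθΘ hθΘ
    simp only [hh]; linarith
  have hev : ∀ᶠ θ' in nhds θ, θ' ∈ Θ ∩ U ∧ h θm / 2 < h θ' := by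
    have hca : ContinuousAt h θ := hcont.continuousAt (mem_interior_iff_mem_nhds.1 hθ)
    filter_upwards [mem_interior_iff_mem_nhds.1 hθ, hU.mem_nhds hθU,
      hca.eventually (lt_mem_nhds (show h θm / 2 < h θ by rw [hself]; linarith))]
      with θ' h1 h2 h3 using ⟨⟨h1, h2⟩, h3⟩
  obtain ⟨W, hW, hWo, hθW⟩ := eventually_nhds_iff.1 hev
  refine ⟨W, hWo, ⟨θ, hθW⟩, fun θ' h' => (hW θ' h').1, ?_⟩
  have hunif := Metric.tendstoUniformlyOn_iff.1 hz.uniform (-(h θm / 2)) (by linarith)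
  filter_upwards [hunif, eventually_gt_atTop 0] with n hn hn0 θ₁ h₁ θ₂ h₂
  have hΘ₂ := (hW θ₂ h₂).1.1
  have hd := hn (θ₁, θ₂) ⟨h₁.1, hΘ₂⟩
  rw [Real.dist_eq, abs_lt] at hd
  have hG := hfam.integral_logRatio_eq_sub hθΘ h₁.1 hΘ₂
  have hm1 : h θ₁ ≤ h θm := hmax h₁
  have hm2 := (hW θ₂ h₂).2
  simp only [hh] at hm1 hm2 hd
  have hlt : (∑ t ∈ Finset.range n, logRatio p θ₁ θ₂ (z t)) / (n : ℝ) < 0 := by linarith [hd.1]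
  have hn0' : (0 : ℝ) < n := by exact_mod_cast hn0
  rw [div_neg_iff] at hlt
  have hsum : ∑ t ∈ Finset.range n, logRatio p θ₁ θ₂ (z t) < 0 := by
    rcases hlt with h | h
    · linarith [h.2]
    · exact h.1
  rw [hz.log_seqLik_sub n h₁.1 hΘ₂] at hsum
  exact ((Real.log_lt_log_iff (hz.seqLik_pos n h₁.1) (hz.seqLik_pos n hΘ₂)).1 (by linarith)).le

lemma setIntegral_seqLik_pos (hfam : RegularFamily ν Θ p) (hz : TypicalSample ν Θ p θ z)
    {U : Set (Param k)} (hU : IsOpen U) (hne : (interior Θ ∩ U).Nonempty) (n : ℕ) :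
    0 < ∫ θ' in Θ ∩ U, seqLik p z n θ' := by
  have hmeas : MeasurableSet (Θ ∩ U) := hfam.isCompact.measurableSet.inter hU.measurableSet
  rw [setIntegral_pos_iff_support_of_nonneg_ae]
  · refine ((isOpen_interior.inter hU).measure_pos volume hne).trans_le (measure_mono ?_)
    intro θ' h'
    exact ⟨(hz.seqLik_pos n (interior_subset h'.1)).ne', interior_subset h'.1, h'.2⟩
  · exact (ae_restrict_mem hmeas).mono fun θ' h' => (hz.seqLik_pos n h'.1).le
  · exact (hfam.integrableOn_seqLik z n).mono_set Set.inter_subset_left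

lemma setIntegral_seqLik_inter_le (hfam : RegularFamily ν Θ p) (U : Set (Param k)) (n : ℕ) :
    ∫ θ' in Θ ∩ U, seqLik p z n θ' ≤ ∫ θ' in Θ, seqLik p z n θ' :=
  setIntegral_mono_set (hfam.integrableOn_seqLik z n)
    ((ae_restrict_mem hfam.isCompact.measurableSet).mono fun _ h' => hfam.seqLik_nonneg z n h')
    Set.inter_subset_left.eventuallyLE

/-- For boundedly many observations, every open set meeting the interior of the parameter space
keeps a positive fraction of the posterior mass. -/
lemma exists_mass_of_le (hfam : RegularFamily ν Θ p) (hz : TypicalSample ν Θ p θ z)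
    {U : Set (Param k)} (hU : IsOpen U) (hne : (interior Θ ∩ U).Nonempty) (N : ℕ) :
    ∃ c : ℝ, 0 < c ∧ ∀ n ≤ N,
      c * ∫ θ' in Θ, seqLik p z n θ' ≤ ∫ θ' in Θ ∩ U, seqLik p z n θ' := by
  have hpos := hz.setIntegral_seqLik_pos hfam hU hne
  have htot : ∀ n, 0 < ∫ θ' in Θ, seqLik p z n θ' := fun n =>
    (hpos n).trans_le (setIntegral_seqLik_inter_le hfam U n)
  obtain ⟨i, -, hi⟩ := (Finset.range (N + 1)).exists_min_image
    (fun n => (∫ θ' in Θ ∩ U, seqLik p z n θ') / ∫ θ' in Θ, seqLik p z n θ') ⟨0, by simp⟩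
  exact ⟨_, div_pos (hpos i) (htot i), fun n hn =>
    (le_div_iff₀ (htot n)).1 (hi n (by simpa [Nat.lt_succ_iff] using hn))⟩

/-- Weak posterior consistency: however many observations are made, a neighborhood of the true
parameter keeps a fixed positive fraction of the posterior mass. -/
lemma exists_mass (hfam : RegularFamily ν Θ p) (hz : TypicalSample ν Θ p θ z)
    (hθ : θ ∈ interior Θ) {U : Set (Param k)} (hU : IsOpen U) (hθU : θ ∈ U) :
    ∃ c : ℝ, 0 < c ∧ ∀ n,
      c * ∫ θ' in Θ, seqLik p z n θ' ≤ ∫ θ' in Θ ∩ U, seqLik p z n θ' := by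
  obtain ⟨W, hWo, hWne, hWU, hW⟩ := hz.exists_open_seqLik_le hfam hθ hU hθU
  obtain ⟨N, hN⟩ := eventually_atTop.1 hW
  obtain ⟨c₁, hc₁, h₁⟩ := hz.exists_mass_of_le hfam hU ⟨θ, hθ, hθU⟩ N
  have hΘfin : volume Θ ≠ ⊤ := hfam.isCompact.measure_lt_top.ne
  have hWfin : volume W ≠ ⊤ := measure_ne_top_of_subset (hWU.trans Set.inter_subset_left) hΘfin
  have hWpos : 0 < volume.real W :=
    ENNReal.toReal_pos (hWo.measure_pos volume hWne).ne' hWfin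
  have hΘm := hfam.isCompact.measurableSet
  have hΘU : MeasurableSet (Θ \ U) := hΘm.diff hU.measurableSet
  have hVpos : 0 ≤ volume.real (Θ \ U) := measureReal_nonneg
  have hCfin : volume (Θ \ U) ≠ ⊤ := measure_ne_top_of_subset Set.sdiff_subset hΘfin
  refine ⟨min c₁ (volume.real W / (volume.real W + volume.real (Θ \ U))),
    lt_min hc₁ (by positivity), fun n => ?_⟩
  have htot : 0 ≤ ∫ θ' in Θ, seqLik p z n θ' :=
    setIntegral_nonneg hΘm fun θ' h' => hfam.seqLik_nonneg z n h'
  rcases le_total n N with hn | hn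
  · exact (mul_le_mul_of_nonneg_right (min_le_left _ _) htot).trans (h₁ n hn)
  refine (mul_le_mul_of_nonneg_right (min_le_right _ _) htot).trans ?_
  have hint := hfam.integrableOn_seqLik z n
  have hbound : ∀ θ₂ ∈ W,
      ∫ θ' in Θ \ U, seqLik p z n θ' ≤ volume.real (Θ \ U) * seqLik p z n θ₂ := by
    intro θ₂ h₂
    calc ∫ θ' in Θ \ U, seqLik p z n θ' ≤ ∫ _ in Θ \ U, seqLik p z n θ₂ :=
          setIntegral_mono_on (hint.mono_set Set.sdiff_subset) (integrableOn_const hCfin) hΘU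
            fun θ₁ h₁ => hN n hn θ₁ h₁ θ₂ h₂
      _ = _ := by rw [setIntegral_const, smul_eq_mul]
  have hintW : IntegrableOn (seqLik p z n) W := hint.mono_set (hWU.trans Set.inter_subset_left)
  -- Averaging the previous bound over `W` compares the mass outside `U` with the mass inside.
  have havg : volume.real W * ∫ θ' in Θ \ U, seqLik p z n θ' ≤
      volume.real (Θ \ U) * ∫ θ' in Θ ∩ U, seqLik p z n θ' := by
    calc volume.real W * ∫ θ' in Θ \ U, seqLik p z n θ'
        = ∫ _ in W, (∫ θ' in Θ \ U, seqLik p z n θ') := by rw [setIntegral_const, smul_eq_mul]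
      _ ≤ ∫ θ₂ in W, volume.real (Θ \ U) * seqLik p z n θ₂ :=
          setIntegral_mono_on (integrableOn_const hWfin) (hintW.const_mul _) hWo.measurableSet
            hbound
      _ = volume.real (Θ \ U) * ∫ θ₂ in W, seqLik p z n θ₂ := integral_const_mul _ _
      _ ≤ _ := by
          refine mul_le_mul_of_nonneg_left (setIntegral_mono_set
            (hint.mono_set Set.inter_subset_left) ?_ hWU.eventuallyLE) hVpos
          exact (ae_restrict_mem (hΘm.inter hU.measurableSet)).mono
            fun _ h' => hfam.seqLik_nonneg z n h'.1
  rw [← integral_inter_add_sdiff hU.measurableSet hint, div_mul_eq_mul_div,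
    div_le_iff₀ (by positivity)]
  linarith

end TypicalSample

/-! ### The posterior as a product over designs -/

/-- The likelihood factors over designs, when `x d` lists the outputs of `d` in the order in which
they were observed. -/
lemma likelihood_eq_prod_seqLik {𝒟 : Type*} [Fintype 𝒟] [DecidableEq 𝒟] (D : ℕ → 𝒟)
    (y : ℕ → 𝒟 → ℝ) (x : 𝒟 → ℕ → ℝ)
    (hx : ∀ d t, D t = d → x d (Nat.count (fun s => D s = d) t) = y t d) (t : ℕ)
    (θ : 𝒟 → Param k) :
    likelihood p D (fun s => y s (D s)) t θ =
      ∏ d, seqLik p (x d) (Nat.count (fun s => D s = d) t) (θ d) := by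
  induction t with
  | zero => simp [likelihood, seqLik]
  | succ t ih =>
    have hstep : ∀ d, seqLik p (x d) (Nat.count (fun s => D s = d) (t + 1)) (θ d) =
        seqLik p (x d) (Nat.count (fun s => D s = d) t) (θ d) *
          if D t = d then p (θ d) (y t d) else 1 := by
      intro d
      rw [Nat.count_succ]
      split_ifs with h
      · rw [seqLik, Finset.prod_range_succ, hx d t h, seqLik]
      · rw [add_zero, mul_one]
    rw [Finset.prod_congr rfl fun d _ => hstep d, Finset.prod_mul_distrib, ← ih,
      Finset.prod_ite_eq, if_pos (Finset.mem_univ _), likelihood, Finset.prod_range_succ,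
      likelihood]

section Posterior

variable {𝒟 : Type*} [Fintype 𝒟] {x : 𝒟 → ℕ → ℝ} {θstar : 𝒟 → Param k}

lemma prod_setIntegral_pos (hfam : RegularFamily ν Θ p)
    (hxt : ∀ d, TypicalSample ν Θ p (θstar d) (x d)) (hθ : ∀ d, θstar d ∈ interior Θ)
    (n : 𝒟 → ℕ) : 0 < ∏ d, ∫ θ in Θ, seqLik p (x d) (n d) θ :=
  Finset.prod_pos fun d _ => by
    simpa using (hxt d).setIntegral_seqLik_pos hfam isOpen_univ
      ⟨θstar d, hθ d, Set.mem_univ _⟩ (n d)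

variable [DecidableEq 𝒟] {D : ℕ → 𝒟} {y : ℕ → 𝒟 → ℝ}

lemma lintegral_likelihood_pi (hfam : RegularFamily ν Θ p)
    (hx : ∀ d t, D t = d → x d (Nat.count (fun s => D s = d) t) = y t d) (t : ℕ)
    {A : 𝒟 → Set (Param k)} (hA : ∀ d, MeasurableSet (A d)) (hAΘ : ∀ d, A d ⊆ Θ) :
    ∫⁻ θ in Set.univ.pi A, ENNReal.ofReal (likelihood p D (fun s => y s (D s)) t θ) =
      ENNReal.ofReal (∏ d, ∫ θ in A d,
        seqLik p (x d) (Nat.count (fun s => D s = d) t) θ) := by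
  simp_rw [likelihood_eq_prod_seqLik D y x hx t]
  rw [← integral_fintype_prod_eq_prod, ← Measure.restrict_pi_pi, ← volume_pi,
    ofReal_integral_eq_lintegral_ofReal]
  · rw [volume_pi, Measure.restrict_pi_pi]
    exact Integrable.fintype_prod_dep fun d => (hfam.integrableOn_seqLik _ _).mono_set (hAΘ d)
  · filter_upwards [ae_restrict_mem (MeasurableSet.univ_pi hA)] with θ hθ
    exact Finset.prod_nonneg fun d _ =>
      hfam.seqLik_nonneg _ _ (hAΘ d (hθ d (Set.mem_univ d)))

lemma posterior_univ_pi (hfam : RegularFamily ν Θ p)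
    (hx : ∀ d t, D t = d → x d (Nat.count (fun s => D s = d) t) = y t d) (t : ℕ)
    {U : 𝒟 → Set (Param k)} (hU : ∀ d, MeasurableSet (U d)) :
    posterior Θ p D (fun s => y s (D s)) t (Set.univ.pi U) =
      (ENNReal.ofReal (∏ d, ∫ θ in Θ,
        seqLik p (x d) (Nat.count (fun s => D s = d) t) θ))⁻¹ *
      ENNReal.ofReal (∏ d, ∫ θ in Θ ∩ U d,
        seqLik p (x d) (Nat.count (fun s => D s = d) t) θ) := by
  have hΘ := hfam.isCompact.measurableSet
  rw [posterior, Measure.smul_apply, smul_eq_mul, withDensity_apply _ (MeasurableSet.univ_pi hU),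
    Measure.restrict_restrict (MeasurableSet.univ_pi hU), ← Set.pi_inter_distrib,
    lintegral_likelihood_pi hfam hx t (fun _ => hΘ) (fun _ => subset_rfl),
    lintegral_likelihood_pi hfam hx t (fun d => (hU d).inter hΘ) (fun _ => Set.inter_subset_right)]
  simp_rw [Set.inter_comm]

lemma isProbabilityMeasure_posterior (hfam : RegularFamily ν Θ p)
    (hx : ∀ d t, D t = d → x d (Nat.count (fun s => D s = d) t) = y t d)
    (hxt : ∀ d, TypicalSample ν Θ p (θstar d) (x d)) (hθ : ∀ d, θstar d ∈ interior Θ) (t : ℕ) :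
    IsProbabilityMeasure (posterior Θ p D (fun s => y s (D s)) t) := by
  constructor
  have h := posterior_univ_pi hfam hx t (U := fun _ => Set.univ) fun _ => MeasurableSet.univ
  simp only [Set.pi_univ, Set.inter_univ] at h
  rw [h]
  exact ENNReal.inv_mul_cancel
    (ENNReal.ofReal_pos.2 (prod_setIntegral_pos hfam hxt hθ _)).ne' ENNReal.ofReal_ne_top

/-- Posterior independence of the designs: a product of events has at least the product of lower
bounds for the masses of its factors. -/
lemma le_posterior_pi (hfam : RegularFamily ν Θ p)
    (hx : ∀ d t, D t = d → x d (Nat.count (fun s => D s = d) t) = y t d)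
    (hxt : ∀ d, TypicalSample ν Θ p (θstar d) (x d)) (hθ : ∀ d, θstar d ∈ interior Θ) (t : ℕ)
    {U : 𝒟 → Set (Param k)} (hU : ∀ d, MeasurableSet (U d)) {c : 𝒟 → ℝ} (hc : ∀ d, 0 ≤ c d)
    (hcU : ∀ d, c d * ∫ θ in Θ, seqLik p (x d) (Nat.count (fun s => D s = d) t) θ ≤
      ∫ θ in Θ ∩ U d, seqLik p (x d) (Nat.count (fun s => D s = d) t) θ) :
    ∏ d, c d ≤ (posterior Θ p D (fun s => y s (D s)) t).real (Set.univ.pi U) := by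
  have hpos := prod_setIntegral_pos hfam hxt hθ fun d => Nat.count (fun s => D s = d) t
  have hnn : ∀ d, 0 ≤ ∫ θ in Θ, seqLik p (x d) (Nat.count (fun s => D s = d) t) θ := fun d =>
    setIntegral_nonneg hfam.isCompact.measurableSet fun _ h => hfam.seqLik_nonneg _ _ h
  rw [measureReal_def, posterior_univ_pi hfam hx t hU, ENNReal.toReal_mul, ENNReal.toReal_inv,
    ENNReal.toReal_ofReal hpos.le, ENNReal.toReal_ofReal
      (Finset.prod_nonneg fun d _ => (mul_nonneg (hc d) (hnn d)).trans (hcU d)),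
    inv_mul_eq_div, le_div_iff₀ hpos, ← Finset.prod_mul_distrib]
  exact Finset.prod_le_prod (fun d _ => mul_nonneg (hc d) (hnn d)) fun d _ => hcU d

end Posterior

/-! ### Lower bound for the allocation probability -/

section Policy

variable {𝒞 𝒟 : Type*} [Fintype 𝒟] [LinearOrder 𝒟] {ctx : 𝒟 → 𝒞} {m : 𝒞 → ℕ}

lemma mem_topSet_of_forall_lt {d : 𝒟} (hm : 1 ≤ m (ctx d)) {θ : 𝒟 → Param k}
    (h : ∀ d', d' ≠ d → (θ d').1 < (θ d).1) : d ∈ topSet ctx m θ (ctx d) := by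
  classical
  simp only [topSet, Finset.mem_filter, Finset.mem_univ, true_and]
  rw [Finset.filter_false_of_mem, Finset.card_empty]
  · omega
  · rintro d' - ⟨-, h' | h'⟩
    · rcases eq_or_ne d' d with rfl | hne
      · exact lt_irrefl _ h'
      · exact lt_asymm h' (h d' hne)
    · exact (h d' h'.2.ne).ne h'.1

lemma notMem_topSet_of_forall_lt {d : 𝒟} (hm : m (ctx d) < Nat.card {d' : 𝒟 // ctx d' = ctx d})
    {θ : 𝒟 → Param k} (h : ∀ d', d' ≠ d → (θ d).1 < (θ d').1) :
    d ∉ topSet ctx m θ (ctx d) := by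
  classical
  simp only [topSet, Finset.mem_filter, Finset.mem_univ, true_and, not_lt]
  rw [Nat.card_eq_fintype_card, Fintype.card_subtype] at hm
  have hsub : (Finset.univ.filter fun d' => ctx d' = ctx d).erase d ⊆
      Finset.univ.filter fun d' => ctx d' = ctx d ∧
        ((θ d).1 < (θ d').1 ∨ ((θ d').1 = (θ d).1 ∧ d' < d)) := by
    intro d' hd'
    simp only [Finset.mem_erase, Finset.mem_filter, Finset.mem_univ, true_and] at hd' ⊢
    exact ⟨hd'.2, Or.inl (h d' hd'.1)⟩
  have := Finset.card_le_card hsub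
  rw [Finset.card_erase_of_mem (by simp)] at this
  omega

lemma stopIndex_eq_zero {θ₁ : 𝒟 → Param k} {s : ℕ → 𝒟 → Param k}
    (h : topSet ctx m (s 0) ≠ topSet ctx m θ₁) : stopIndex ctx m θ₁ s = 0 :=
  Nat.sInf_eq_zero.2 (Or.inl h)

lemma inv_card_mul_inv_card_le {𝒞 𝒟 : Type*} [Fintype 𝒞] [Fintype 𝒟] {s : Finset 𝒞} {u : Finset 𝒟}
    (hs : s.Nonempty) (hu : u.Nonempty) :
    ((Fintype.card 𝒞 * Fintype.card 𝒟 : ℕ) : ℝ)⁻¹ ≤ (s.card : ℝ)⁻¹ * (u.card : ℝ)⁻¹ := by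
  have h1 : (0 : ℝ) < s.card := by exact_mod_cast hs.card_pos
  have h2 : (0 : ℝ) < u.card := by exact_mod_cast hu.card_pos
  rw [← mul_inv]
  refine inv_anti₀ (by positivity) ?_
  exact_mod_cast Nat.mul_le_mul (Finset.card_le_univ s) (Finset.card_le_univ u)

lemma allocProb_le_one {𝒞 𝒟 : Type*} [Fintype 𝒞] [LinearOrder 𝒟] {ctx : 𝒟 → 𝒞} {γ : 𝒞 → ℝ}
    (hγ : ∀ c, γ c ∈ Set.Ioo (0 : ℝ) 1) (P₁ P₂ : 𝒞 → Finset 𝒟) (d : 𝒟) :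
    allocProb ctx γ P₁ P₂ d ≤ 1 := by
  classical
  obtain ⟨h0, h1⟩ := hγ (ctx d)
  have hinv : ∀ n : ℕ, (n : ℝ)⁻¹ ≤ 1 := Nat.cast_inv_le_one
  have hinv0 : ∀ n : ℕ, 0 ≤ (n : ℝ)⁻¹ := fun n => by positivity
  rw [allocProb]
  refine mul_le_one₀ (hinv _) ?_ ?_
  · have := mul_nonneg h0.le (hinv0 (P₁ (ctx d) \ P₂ (ctx d)).card)
    have := mul_nonneg (sub_nonneg.2 h1.le) (hinv0 (P₂ (ctx d) \ P₁ (ctx d)).card)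
    split_ifs <;> linarith
  · have := mul_le_of_le_one_right h0.le (hinv (P₁ (ctx d) \ P₂ (ctx d)).card)
    have := mul_le_of_le_one_right (sub_nonneg.2 h1.le) (hinv (P₂ (ctx d) \ P₁ (ctx d)).card)
    split_ifs <;> linarith

variable [Fintype 𝒞] {γ : 𝒞 → ℝ} {P₁ P₂ : 𝒞 → Finset 𝒟} {d : 𝒟}

lemma le_allocProb_of_mem_left (hγ : ∀ c, γ c ∈ Set.Ioo (0 : ℝ) 1) (h₁ : d ∈ P₁ (ctx d))
    (h₂ : d ∉ P₂ (ctx d)) :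
    γ (ctx d) * ((Fintype.card 𝒞 * Fintype.card 𝒟 : ℕ) : ℝ)⁻¹ ≤ allocProb ctx γ P₁ P₂ d := by
  classical
  have hmem : d ∈ P₁ (ctx d) \ P₂ (ctx d) := Finset.mem_sdiff.2 ⟨h₁, h₂⟩
  have hmem' : d ∉ P₂ (ctx d) \ P₁ (ctx d) := fun h => h₂ (Finset.mem_sdiff.1 h).1
  have hne : P₁ (ctx d) ≠ P₂ (ctx d) := fun h => h₂ (h ▸ h₁)
  have := inv_card_mul_inv_card_le (s := Finset.univ.filter fun c => P₁ c ≠ P₂ c)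
    ⟨ctx d, by simpa using hne⟩ ⟨d, hmem⟩
  have := mul_le_mul_of_nonneg_left this (hγ (ctx d)).1.le
  rw [allocProb, if_pos hmem, if_neg hmem', add_zero]
  refine this.trans (le_of_eq ?_)
  rw [mul_left_comm]

lemma le_allocProb_of_mem_right (hγ : ∀ c, γ c ∈ Set.Ioo (0 : ℝ) 1) (h₁ : d ∉ P₁ (ctx d))
    (h₂ : d ∈ P₂ (ctx d)) :
    (1 - γ (ctx d)) * ((Fintype.card 𝒞 * Fintype.card 𝒟 : ℕ) : ℝ)⁻¹ ≤
      allocProb ctx γ P₁ P₂ d := by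
  classical
  have hmem : d ∈ P₂ (ctx d) \ P₁ (ctx d) := Finset.mem_sdiff.2 ⟨h₂, h₁⟩
  have hmem' : d ∉ P₁ (ctx d) \ P₂ (ctx d) := fun h => h₁ (Finset.mem_sdiff.1 h).1
  have hne : P₁ (ctx d) ≠ P₂ (ctx d) := fun h => h₁ (h ▸ h₂)
  have := inv_card_mul_inv_card_le (s := Finset.univ.filter fun c => P₁ c ≠ P₂ c)
    ⟨ctx d, by simpa using hne⟩ ⟨d, hmem⟩
  have := mul_le_mul_of_nonneg_left this (sub_nonneg.2 (hγ (ctx d)).2.le)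
  rw [allocProb, if_neg hmem', if_pos hmem, zero_add]
  refine this.trans (le_of_eq ?_)
  rw [mul_left_comm]

/-- If the posterior gives mass to an event `A` on which `d` is in the top set of its context and
to an event `B` on which it is not, the algorithm simulates `d` with a probability that is bounded
below independently of `γ`. Only the first re-sample is used. The two orders of `A` and `B`
contribute with weights `γ` and `1 - γ`, which add up to one. -/
lemma le_topTwoPolicy {post : Measure (𝒟 → Param k)} [IsProbabilityMeasure post]
    (hγ : ∀ c, γ c ∈ Set.Ioo (0 : ℝ) 1) {A B : Set (𝒟 → Param k)} (hAm : MeasurableSet A)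
    (hBm : MeasurableSet B) (hA : ∀ θ ∈ A, d ∈ topSet ctx m θ (ctx d))
    (hB : ∀ θ ∈ B, d ∉ topSet ctx m θ (ctx d)) :
    ((Fintype.card 𝒞 * Fintype.card 𝒟 : ℕ) : ℝ)⁻¹ * (post.real A * post.real B) ≤
      topTwoPolicy ctx m post γ d := by
  set q : ℝ := ((Fintype.card 𝒞 * Fintype.card 𝒟 : ℕ) : ℝ)⁻¹
  have hq : 0 ≤ q := by positivity
  obtain ⟨h0, h1⟩ := hγ (ctx d)
  set F : (𝒟 → Param k) → (ℕ → 𝒟 → Param k) → ENNReal := fun θ₁ s => ENNReal.ofReal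
    (allocProb ctx γ (topSet ctx m θ₁) (topSet ctx m (s (stopIndex ctx m θ₁ s))) d)
  have hev : ∀ S : Set (𝒟 → Param k), MeasurableSet S →
      Measure.infinitePi (fun _ : ℕ => post) {s | s 0 ∈ S} = post S := fun S hS =>
    (measurePreserving_eval_infinitePi (fun _ : ℕ => post) 0).measure_preimage hS.nullMeasurableSet
  have hpm : ∀ S : Set (𝒟 → Param k), MeasurableSet S →
      MeasurableSet {s : ℕ → 𝒟 → Param k | s 0 ∈ S} := fun S hS => measurable_pi_apply 0 hS
  have hFA : ∀ θ₁ ∈ A, ENNReal.ofReal (γ (ctx d) * q) * post B ≤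
      ∫⁻ s, F θ₁ s ∂(Measure.infinitePi fun _ : ℕ => post) := by
    intro θ₁ h₁
    rw [← hev B hBm, ← lintegral_indicator_const (hpm B hBm)]
    refine lintegral_mono (Set.indicator_le fun s (hs : s 0 ∈ B) => ?_)
    have hidx : stopIndex ctx m θ₁ s = 0 :=
      stopIndex_eq_zero fun h => hB _ hs (h ▸ hA _ h₁)
    simp only [F, hidx]
    exact ENNReal.ofReal_le_ofReal (le_allocProb_of_mem_left hγ (hA _ h₁) (hB _ hs))
  have hFB : ∀ θ₁ ∈ B, ENNReal.ofReal ((1 - γ (ctx d)) * q) * post A ≤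
      ∫⁻ s, F θ₁ s ∂(Measure.infinitePi fun _ : ℕ => post) := by
    intro θ₁ h₁
    rw [← hev A hAm, ← lintegral_indicator_const (hpm A hAm)]
    refine lintegral_mono (Set.indicator_le fun s (hs : s 0 ∈ A) => ?_)
    have hidx : stopIndex ctx m θ₁ s = 0 :=
      stopIndex_eq_zero fun h => hB _ h₁ (h ▸ hA _ hs)
    simp only [F, hidx]
    exact ENNReal.ofReal_le_ofReal (le_allocProb_of_mem_right hγ (hB _ h₁) (hA _ hs))
  -- `A` and `B` are disjoint, so the contributions of `θ₁ ∈ A` and `θ₁ ∈ B` add up.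
  have hlow : ENNReal.ofReal (γ (ctx d) * q) * post B * post A +
      ENNReal.ofReal ((1 - γ (ctx d)) * q) * post A * post B ≤
      ∫⁻ θ₁, ∫⁻ s, F θ₁ s ∂(Measure.infinitePi fun _ : ℕ => post) ∂post := by
    rw [← lintegral_indicator_const hAm (_ * post B),
      ← lintegral_indicator_const hBm (_ * post A),
      ← lintegral_add_left (measurable_const.indicator hAm)]
    refine lintegral_mono fun θ₁ => ?_
    by_cases hθA : θ₁ ∈ A
    · have hθB : θ₁ ∉ B := fun h => hB _ h (hA _ hθA)
      simpa [hθA, hθB] using hFA θ₁ hθA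
    · by_cases hθB : θ₁ ∈ B
      · simpa [hθA, hθB] using hFB θ₁ hθB
      · simp [hθA, hθB]
  have hfin : ∫⁻ θ₁, ∫⁻ s, F θ₁ s ∂(Measure.infinitePi fun _ : ℕ => post) ∂post ≠ ⊤ := by
    refine ne_top_of_le_ne_top ENNReal.one_ne_top ?_
    have h1 : ∀ θ₁, ∫⁻ s, F θ₁ s ∂(Measure.infinitePi fun _ : ℕ => post) ≤ 1 := fun θ₁ =>
      (lintegral_mono fun s => ENNReal.ofReal_le_one.2 (allocProb_le_one hγ _ _ d)).trans
        (by simp)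
    exact (lintegral_mono h1).trans (by simp)
  refine le_trans (le_of_eq ?_) (ENNReal.toReal_mono hfin hlow)
  rw [ENNReal.toReal_add (by finiteness) (by finiteness)]
  simp only [ENNReal.toReal_mul, measureReal_def]
  rw [ENNReal.toReal_ofReal (mul_nonneg h0.le hq),
    ENNReal.toReal_ofReal (mul_nonneg (sub_nonneg.2 h1.le) hq)]
  ring

end Policy

/-! ### Optional skipping: the observed outputs of one design form an i.i.d. sequence -/

section Fill

variable {α : Type*} (P : ℕ → Prop) [DecidablePred P] (v : ℕ → α) (w : α) (j t : ℕ)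

/-- The value of `v` at the `j`-th time at which `P` holds if this time comes before `t`, and the
default value `w` otherwise. -/
noncomputable def fillAt : α := if j < Nat.count P t then v (Nat.nth P j) else w

open Classical in
/-- The value of `v` at the `j`-th time at which `P` holds, or the default value `w` if `P` holds
at most `j` times. -/
noncomputable def fill : α := if ∃ t, j < Nat.count P t then v (Nat.nth P j) else w

@[simp]
lemma fillAt_zero : fillAt P v w j 0 = w := by simp [fillAt]

lemma fillAt_succ : fillAt P v w j (t + 1) =
    if P t ∧ Nat.count P t = j then v t else fillAt P v w j t := by
  by_cases hP : P t
  · rcases lt_trichotomy (Nat.count P t) j with h | rfl | h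
    · have h1 : ¬ j < Nat.count P t + 1 := by omega
      have h2 : ¬ j < Nat.count P t := by omega
      simp [fillAt, Nat.count_succ, hP, h.ne, h1, h2]
    · simp [fillAt, Nat.count_succ, hP, Nat.nth_count hP]
    · have h1 : j < Nat.count P t + 1 := by omega
      simp [fillAt, Nat.count_succ, hP, h.ne', h1, h]
  · simp [fillAt, Nat.count_succ, hP]

lemma fillAt_eq_of_count_le (h : Nat.count P t ≤ j) : fillAt P v w j t = w :=
  if_neg h.not_gt

lemma eventually_fillAt_eq : ∀ᶠ t in atTop, fillAt P v w j t = fill P v w j := by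
  by_cases h : ∃ t, j < Nat.count P t
  · obtain ⟨t₀, ht₀⟩ := h
    filter_upwards [eventually_ge_atTop t₀] with t ht
    rw [fillAt, if_pos (ht₀.trans_le (Nat.count_monotone P ht)), fill, if_pos ⟨t₀, ht₀⟩]
  · refine Eventually.of_forall fun t => ?_
    rw [fillAt, if_neg fun ht => h ⟨t, ht⟩, fill, if_neg h]

lemma fill_count (hP : P t) : fill P v w (Nat.count P t) = v t := by
  rw [fill, if_pos ⟨t + 1, by simp [Nat.count_succ, hP]⟩, Nat.nth_count hP]

end Fill

/-- A product of filled values, split according to which factor `t` is used for at time `t`: that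
factor is still the default one before time `t + 1`. -/
lemma prod_fillAt_eq (P : ℕ → Prop) [DecidablePred P] (v : ℕ → ℕ → ENNReal) (w : ℕ → ENNReal)
    (s : Finset ℕ) (t : ℕ) :
    ∏ j ∈ s, fillAt P (v j) (w j) j t =
      (if P t ∧ Nat.count P t ∈ s then 0 else ∏ j ∈ s, fillAt P (v j) (w j) j t) +
      ∑ i ∈ s, (if P t ∧ Nat.count P t = i then
        ∏ j ∈ s.erase i, fillAt P (v j) (w j) j t else 0) * w i := by
  by_cases h : P t ∧ Nat.count P t ∈ s
  · rw [if_pos h, zero_add, Finset.sum_eq_single_of_mem _ h.2, if_pos ⟨h.1, rfl⟩,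
      ← Finset.prod_erase_mul _ _ h.2, fillAt_eq_of_count_le _ _ _ _ _ le_rfl]
    intro i _ hi
    rw [if_neg fun h' => hi h'.2.symm, zero_mul]
  · rw [if_neg h, Finset.sum_eq_zero, add_zero]
    intro i hi
    rw [if_neg, zero_mul]
    rintro ⟨h1, rfl⟩
    exact h ⟨h1, hi⟩

lemma prod_fillAt_succ_eq (P : ℕ → Prop) [DecidablePred P] (v : ℕ → ℕ → ENNReal)
    (w : ℕ → ENNReal) (s : Finset ℕ) (t : ℕ) :
    ∏ j ∈ s, fillAt P (v j) (w j) j (t + 1) =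
      (if P t ∧ Nat.count P t ∈ s then 0 else ∏ j ∈ s, fillAt P (v j) (w j) j t) +
      ∑ i ∈ s, (if P t ∧ Nat.count P t = i then
        ∏ j ∈ s.erase i, fillAt P (v j) (w j) j t else 0) * v i t := by
  simp_rw [fillAt_succ]
  by_cases h : P t ∧ Nat.count P t ∈ s
  · rw [if_pos h, zero_add, Finset.sum_eq_single_of_mem _ h.2, if_pos ⟨h.1, rfl⟩,
      ← Finset.prod_erase_mul _ _ h.2, if_pos ⟨h.1, rfl⟩]
    · congr 1
      refine Finset.prod_congr rfl fun j hj => ?_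
      rw [if_neg fun h' => Finset.ne_of_mem_erase hj h'.2.symm]
    · intro i _ hi
      rw [if_neg fun h' => hi h'.2.symm, zero_mul]
  · rw [if_neg h, Finset.sum_eq_zero, add_zero]
    · refine Finset.prod_congr rfl fun j hj => ?_
      rw [if_neg]
      rintro ⟨h1, rfl⟩
      exact h ⟨h1, hj⟩
    · intro i hi
      rw [if_neg, zero_mul]
      rintro ⟨h1, rfl⟩
      exact h ⟨h1, hi⟩

section Measurability

variable {Ω α : Type*} [MeasurableSpace Ω] [MeasurableSpace α] {P : Ω → ℕ → Prop}
  [∀ ω, DecidablePred (P ω)] {v : Ω → ℕ → α} {w : Ω → α}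

lemma measurable_count {t : ℕ} (hP : ∀ s < t, MeasurableSet {ω | P ω s}) :
    Measurable fun ω => Nat.count (P ω) t := by
  induction t with
  | zero => simp
  | succ t ih =>
    simp_rw [Nat.count_succ]
    exact (ih fun s hs => hP s (by omega)).add
      (Measurable.ite (hP t t.lt_succ_self) measurable_const measurable_const)

lemma measurable_fillAt {t : ℕ} (hP : ∀ s < t, MeasurableSet {ω | P ω s})
    (hv : ∀ s < t, Measurable fun ω => v ω s) (hw : Measurable w) (j : ℕ) :
    Measurable fun ω => fillAt (P ω) (v ω) (w ω) j t := by
  induction t with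
  | zero => simpa using hw
  | succ t ih =>
    simp_rw [fillAt_succ]
    have hc := measurable_count (P := P) (t := t) fun s hs => hP s (by omega)
    exact Measurable.ite ((hP t t.lt_succ_self).inter (hc (measurableSet_singleton j)))
      (hv t t.lt_succ_self) (ih (fun s hs => hP s (by omega)) fun s hs => hv s (by omega))

end Measurability

lemma measurable_fill {Ω : Type*} [MeasurableSpace Ω] {P : Ω → ℕ → Prop}
    [∀ ω, DecidablePred (P ω)] {v : Ω → ℕ → ℝ} {w : Ω → ℝ}
    (hP : ∀ s, MeasurableSet {ω | P ω s}) (hv : ∀ s, Measurable fun ω => v ω s)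
    (hw : Measurable w) (j : ℕ) : Measurable fun ω => fill (P ω) (v ω) (w ω) j :=
  measurable_of_tendsto_metrizable
    (fun t => measurable_fillAt (t := t) (fun s _ => hP s) (fun s _ => hv s) hw j)
    (tendsto_pi_nhds.2 fun _ =>
      tendsto_const_nhds.congr' ((eventually_fillAt_eq _ _ _ _).mono fun _ h => h.symm))

section Skipping

variable {Ω : Type*} [mΩ : MeasurableSpace Ω] {prob : Measure Ω}
  {Q : Measure ℝ} {P : Ω → ℕ → Prop} [∀ ω, DecidablePred (P ω)]
  {X : ℕ → Ω → ℝ} {ℱ : ℕ → MeasurableSpace Ω} {A : ℕ → Set ℝ}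

/-- One step of the martingale argument: at a selected time, replacing the mass of `A i` by the
indicator that the output lies in `A i` does not change the expectation, since the output is
independent of the past and of the selection. -/
lemma lintegral_prod_fillAt_succ (hℱ : ∀ t, ℱ t ≤ mΩ)
    (hP : ∀ t, ∀ s ≤ t, MeasurableSet[ℱ t] {ω | P ω s})
    (hX : ∀ t, ∀ s < t, Measurable[ℱ t] (X s)) (hXm : ∀ t, Measurable (X t))
    (hlaw : ∀ t, prob.map (X t) = Q)
    (hind : ∀ t, Indep (MeasurableSpace.comap (X t) inferInstance) (ℱ t) prob)
    (hA : ∀ j, MeasurableSet (A j)) (s : Finset ℕ) (t : ℕ) :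
    ∫⁻ ω, ∏ j ∈ s, fillAt (P ω) (fun u => (A j).indicator 1 (X u ω)) (Q (A j)) j (t + 1) ∂prob =
      ∫⁻ ω, ∏ j ∈ s, fillAt (P ω) (fun u => (A j).indicator 1 (X u ω)) (Q (A j)) j t ∂prob := by
  have hI : ∀ i, Measurable fun x : ℝ => (A i).indicator (1 : ℝ → ENNReal) x := fun i =>
    measurable_one.indicator (hA i)
  have hfill : ∀ j, Measurable[ℱ t]
      fun ω => fillAt (P ω) (fun u => (A j).indicator (1 : ℝ → ENNReal) (X u ω)) (Q (A j)) j t :=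
    fun j => @measurable_fillAt _ _ (ℱ t) _ _ _ _ _ t (fun u hu => hP t u hu.le)
      (fun u hu => (hI j).comp (hX t u hu)) measurable_const j
  have hcount : Measurable[ℱ t] fun ω => Nat.count (P ω) t :=
    @measurable_count _ (ℱ t) _ _ t fun u hu => hP t u hu.le
  have hG : ∀ i, Measurable[ℱ t] fun ω => if P ω t ∧ Nat.count (P ω) t = i then
      ∏ j ∈ s.erase i, fillAt (P ω) (fun u => (A j).indicator (1 : ℝ → ENNReal) (X u ω))
        (Q (A j)) j t else 0 := fun i =>
    Measurable.ite (p := fun ω => P ω t ∧ Nat.count (P ω) t = i)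
      (@MeasurableSet.inter _ (ℱ t) _ _ (hP t t le_rfl) (hcount (measurableSet_singleton i)))
      (@Finset.measurable_fun_prod _ _ _ _ _ _ (ℱ t) _ _ fun j _ => hfill j) measurable_const
  have hH : Measurable fun ω => if P ω t ∧ Nat.count (P ω) t ∈ s then 0 else
      ∏ j ∈ s, fillAt (P ω) (fun u => (A j).indicator (1 : ℝ → ENNReal) (X u ω))
        (Q (A j)) j t :=
    Measurable.ite ((hℱ t _ (hP t t le_rfl)).inter
      ((hcount.mono (hℱ t) le_rfl) (MeasurableSet.of_discrete (s := (s : Set ℕ)))))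
      measurable_const
      (Finset.measurable_fun_prod _ fun j _ => (hfill j).mono (hℱ t) le_rfl)
  have hXt : ∀ i, Measurable fun ω => (A i).indicator (1 : ℝ → ENNReal) (X t ω) := fun i =>
    (hI i).comp (hXm t)
  have hmean : ∀ i, ∫⁻ ω, (A i).indicator (1 : ℝ → ENNReal) (X t ω) ∂prob = Q (A i) := by
    intro i
    rw [← lintegral_map (hI i) (hXm t), hlaw, lintegral_indicator_one (hA i)]
  have key : ∀ i, ∫⁻ ω, (if P ω t ∧ Nat.count (P ω) t = i then
      ∏ j ∈ s.erase i, fillAt (P ω) (fun u => (A j).indicator (1 : ℝ → ENNReal) (X u ω))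
        (Q (A j)) j t else 0) * (A i).indicator (1 : ℝ → ENNReal) (X t ω) ∂prob =
      ∫⁻ ω, (if P ω t ∧ Nat.count (P ω) t = i then
      ∏ j ∈ s.erase i, fillAt (P ω) (fun u => (A j).indicator (1 : ℝ → ENNReal) (X u ω))
        (Q (A j)) j t else 0) * Q (A i) ∂prob := by
    intro i
    rw [lintegral_mul_const _ ((hG i).mono (hℱ t) le_rfl), ← hmean i]
    exact lintegral_mul_eq_lintegral_mul_lintegral_of_independent_measurableSpace (hℱ t)
      (hXm t).comap_le (hind t).symm (hG i) ((hI i).comp (comap_measurable (X t)))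
  simp_rw [prod_fillAt_succ_eq]
  conv_rhs => enter [2, ω]; rw [prod_fillAt_eq]
  rw [lintegral_add_left hH, lintegral_add_left hH,
    lintegral_finsetSum _ fun i _ => ((hG i).mono (hℱ t) le_rfl).fun_mul (hXt i),
    lintegral_finsetSum _ fun i _ => ((hG i).mono (hℱ t) le_rfl).mul_const _]
  exact congrArg _ (Finset.sum_congr rfl fun i _ => key i)

variable [IsProbabilityMeasure prob] [IsProbabilityMeasure Q]

/-- The martingale of `lintegral_prod_fillAt_succ` is bounded by one and eventually constant along
each path, so its limit has the expectation of its initial value. -/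
lemma lintegral_prod_fill (hℱ : ∀ t, ℱ t ≤ mΩ)
    (hP : ∀ t, ∀ s ≤ t, MeasurableSet[ℱ t] {ω | P ω s})
    (hX : ∀ t, ∀ s < t, Measurable[ℱ t] (X s)) (hXm : ∀ t, Measurable (X t))
    (hlaw : ∀ t, prob.map (X t) = Q)
    (hind : ∀ t, Indep (MeasurableSpace.comap (X t) inferInstance) (ℱ t) prob)
    (hA : ∀ j, MeasurableSet (A j)) (s : Finset ℕ) :
    ∫⁻ ω, ∏ j ∈ s, fill (P ω) (fun u => (A j).indicator 1 (X u ω)) (Q (A j)) j ∂prob =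
      ∏ j ∈ s, Q (A j) := by
  have hconst : ∀ t, ∫⁻ ω, ∏ j ∈ s, fillAt (P ω) (fun u => (A j).indicator 1 (X u ω)) (Q (A j)) j t
      ∂prob = ∏ j ∈ s, Q (A j) := by
    intro t
    induction t with
    | zero => simp
    | succ t ih => rw [lintegral_prod_fillAt_succ hℱ hP hX hXm hlaw hind hA, ih]
  have hlim := tendsto_lintegral_of_dominated_convergence (μ := prob)
    (F := fun t ω => ∏ j ∈ s, fillAt (P ω) (fun u => (A j).indicator 1 (X u ω)) (Q (A j)) j t)
    (f := fun ω => ∏ j ∈ s, fill (P ω) (fun u => (A j).indicator 1 (X u ω)) (Q (A j)) j)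
    (fun _ => 1)
    (fun t => Finset.measurable_fun_prod _ fun j _ => measurable_fillAt
      (fun u _ => hℱ u _ (hP u u le_rfl))
      (fun u _ => (measurable_one.indicator (hA j)).comp (hXm u)) measurable_const j)
    (fun t => Eventually.of_forall fun ω => Finset.prod_le_one' fun j _ => by
      rw [fillAt]
      split_ifs
      · exact Set.indicator_le_self' (fun _ _ => zero_le) _
      · exact prob_le_one)
    (by simp)
    (Eventually.of_forall fun ω => tendsto_const_nhds.congr' <| by
      filter_upwards [(Filter.eventually_all_finset s).2 fun j _ =>
        eventually_fillAt_eq (P ω) (fun u => (A j).indicator 1 (X u ω)) (Q (A j)) j] with t ht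
      exact Finset.prod_congr rfl fun j hj => (ht j hj).symm)
  simp_rw [hconst] at hlim
  exact (tendsto_nhds_unique hlim tendsto_const_nhds)

/-- Optional skipping: the outputs at the successive selected times, continued by independent
copies in case that there are only finitely many of them, are i.i.d. with law `Q`. -/
lemma map_fill_eq_infinitePi (hℱ : ∀ t, ℱ t ≤ mΩ)
    (hP : ∀ t, ∀ s ≤ t, MeasurableSet[ℱ t] {ω | P ω s})
    (hX : ∀ t, ∀ s < t, Measurable[ℱ t] (X s)) (hXm : ∀ t, Measurable (X t))
    (hlaw : ∀ t, prob.map (X t) = Q)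
    (hind : ∀ t, Indep (MeasurableSpace.comap (X t) inferInstance) (ℱ t) prob) :
    (prob.prod (Measure.infinitePi fun _ : ℕ => Q)).map
      (fun q (j : ℕ) => fill (P q.1) (fun u => X u q.1) (q.2 j) j) =
      Measure.infinitePi fun _ : ℕ => Q := by
  have hZ : Measurable fun (q : Ω × (ℕ → ℝ)) (j : ℕ) =>
      fill (P q.1) (fun u => X u q.1) (q.2 j) j :=
    measurable_pi_lambda _ fun j => measurable_fill (P := fun q : Ω × (ℕ → ℝ) => P q.1)
      (fun u => measurable_fst (hℱ u _ (hP u u le_rfl))) (fun u => (hXm u).comp measurable_fst)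
      ((measurable_pi_apply j).comp measurable_snd) j
  refine Measure.eq_infinitePi _ fun s A hA => ?_
  have hSA : MeasurableSet (Set.pi (s : Set ℕ) A) :=
    MeasurableSet.pi s.countable_toSet fun j _ => hA j
  rw [Measure.map_apply hZ hSA, Measure.prod_apply (hZ hSA),
    ← lintegral_prod_fill hℱ hP hX hXm hlaw hind hA s]
  refine lintegral_congr fun ω => ?_
  have hset : Prod.mk ω ⁻¹' ((fun (q : Ω × (ℕ → ℝ)) (j : ℕ) =>
      fill (P q.1) (fun u => X u q.1) (q.2 j) j) ⁻¹' (Set.pi (s : Set ℕ) A)) =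
      Set.pi (s : Set ℕ) fun j => {x | fill (P ω) (fun u => X u ω) x j ∈ A j} := rfl
  have hval : ∀ j, MeasurableSet {x | fill (P ω) (fun u => X u ω) x j ∈ A j} ∧
      Q {x | fill (P ω) (fun u => X u ω) x j ∈ A j} =
        fill (P ω) (fun u => (A j).indicator 1 (X u ω)) (Q (A j)) j := by
    intro j
    by_cases h : ∃ t, j < Nat.count (P ω) t
    · simp only [fill, if_pos h]
      by_cases h' : X (Nat.nth (P ω) j) ω ∈ A j <;> simp [h']
    · simp only [fill, if_neg h]
      exact ⟨hA j, rfl⟩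
  rw [hset, Measure.infinitePi_pi _ fun j _ => (hval j).1]
  exact Finset.prod_congr rfl fun j _ => (hval j).2

end Skipping

/-! ### Information structure of a run -/

section Run

variable {𝒟 Ω : Type*} [MeasurableSpace 𝒟] {D : ℕ → Ω → 𝒟} {Y : ℕ → Ω → 𝒟 → ℝ}

lemma measurable_design_beforeOutput {s t : ℕ} (h : s ≤ t) :
    Measurable[beforeOutput D Y t] (D s) := by
  have h1 : Measurable[MeasurableSpace.comap (fun ω (s : Fin (t + 1)) => D s ω) inferInstance]
      (D s) :=
    (measurable_pi_apply (⟨s, Nat.lt_succ_of_le h⟩ : Fin (t + 1))).comp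
      (comap_measurable fun ω (s : Fin (t + 1)) => D s ω)
  exact h1.mono le_sup_right le_rfl

lemma measurable_output_beforeOutput {s t : ℕ} (h : s < t) :
    Measurable[beforeOutput D Y t] (Y s) := by
  have h1 : Measurable[MeasurableSpace.comap (fun ω (s : Fin t) => Y s ω) inferInstance] (Y s) :=
    (measurable_pi_apply (⟨s, h⟩ : Fin t)).comp (comap_measurable fun ω (s : Fin t) => Y s ω)
  exact h1.mono le_sup_left le_rfl

lemma measurable_design_observed (t : ℕ) : Measurable[observed D Y (t + 1)] (D t) :=
  measurable_fst.comp ((measurable_pi_apply (⟨t, t.lt_succ_self⟩ : Fin (t + 1))).comp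
    (comap_measurable fun ω (s : Fin (t + 1)) => (D s ω, Y s ω (D s ω))))

variable [mΩ : MeasurableSpace Ω]

lemma beforeOutput_le (hD : ∀ t, Measurable (D t)) (hY : ∀ t, Measurable (Y t)) (t : ℕ) :
    beforeOutput D Y t ≤ mΩ :=
  sup_le (measurable_pi_lambda _ fun s : Fin t => hY s).comap_le
    (measurable_pi_lambda _ fun s : Fin (t + 1) => hD s).comap_le

variable [Finite 𝒟] [DiscreteMeasurableSpace 𝒟]

lemma measurable_apply_design (hD : ∀ t, Measurable (D t)) (hY : ∀ t, Measurable (Y t)) (t : ℕ) :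
    Measurable fun ω => Y t ω (D t ω) := by
  intro S hS
  have : (fun ω => Y t ω (D t ω)) ⁻¹' S = ⋃ d, D t ⁻¹' {d} ∩ (fun ω => Y t ω d) ⁻¹' S := by
    ext ω; simp
  rw [this]
  exact MeasurableSet.iUnion fun d => (hD t (measurableSet_singleton d)).inter
    ((measurable_pi_apply d).comp (hY t) hS)

/-- The filtration of the observed information. -/
def observedFiltration (hD : ∀ t, Measurable (D t)) (hY : ∀ t, Measurable (Y t)) :
    Filtration ℕ mΩ where
  seq := observed D Y
  mono' i j hij := by
    have h : Measurable fun (f : Fin j → 𝒟 × ℝ) (s : Fin i) => f (Fin.castLE hij s) :=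
      measurable_pi_lambda _ fun s => measurable_pi_apply _
    exact (h.comp (comap_measurable fun ω (s : Fin j) => (D s ω, Y s ω (D s ω)))).comap_le
  le' t := (measurable_pi_lambda _ fun s : Fin t =>
    (hD s).prodMk (measurable_apply_design hD hY s)).comap_le

end Run

lemma RegularFamily.ae_typicalSample (hfam : RegularFamily ν Θ p) {θ : Param k} (hθ : θ ∈ Θ) :
    ∀ᵐ z ∂(Measure.infinitePi fun _ : ℕ => sampleLaw ν p θ), TypicalSample ν Θ p θ z := by
  have := hfam.isProbabilityMeasure hθ
  have hpos : ∀ᵐ z ∂(Measure.infinitePi fun _ : ℕ => sampleLaw ν p θ),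
      ∀ n, ∀ θ' ∈ Θ, 0 < p θ' (z n) := ae_all_iff.2 fun n =>
    (measurePreserving_eval_infinitePi (fun _ : ℕ => sampleLaw ν p θ) n).quasiMeasurePreserving.ae
      (hfam.pos θ hθ)
  filter_upwards [hpos, hfam.glivenkoCantelli θ hθ] with z h1 h2 using ⟨h1, h2⟩

/-- Almost surely, the outputs of a design that are observed during the run can be continued to a
typical sample. -/
lemma IsTopTwoRun.ae_exists_typicalSample {𝒞 𝒟 Ω : Type*} [Fintype 𝒞] [Fintype 𝒟] [LinearOrder 𝒟]
    [MeasurableSpace 𝒟] [DiscreteMeasurableSpace 𝒟] [MeasurableSpace Ω] {prob : Measure Ω}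
    [IsProbabilityMeasure prob] {θstar : 𝒟 → Param k} {ctx : 𝒟 → 𝒞} {m : 𝒞 → ℕ}
    {γ : ℕ → Ω → 𝒞 → ℝ} {D : ℕ → Ω → 𝒟} {Y : ℕ → Ω → 𝒟 → ℝ} (hfam : RegularFamily ν Θ p)
    (hrun : IsTopTwoRun prob ν Θ p θstar ctx m γ D Y) (hθ : ∀ d, θstar d ∈ Θ) (d : 𝒟) :
    ∀ᵐ ω ∂prob, ∃ x : ℕ → ℝ, TypicalSample ν Θ p (θstar d) x ∧
      ∀ t, D t ω = d → x (Nat.count (fun s => D s ω = d) t) = Y t ω d := by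
  have hQ : ∀ d, IsProbabilityMeasure (sampleLaw ν p (θstar d)) := fun d =>
    hfam.isProbabilityMeasure (hθ d)
  have hXm : ∀ t, Measurable fun ω => Y t ω d := fun t =>
    (measurable_pi_apply d).comp (hrun.measurable_output t)
  have hlaw : ∀ t, prob.map (fun ω => Y t ω d) = sampleLaw ν p (θstar d) := by
    intro t
    rw [← (measurePreserving_eval (fun d => sampleLaw ν p (θstar d)) d).map_eq,
      ← hrun.map_output t, Measure.map_map (measurable_pi_apply d) (hrun.measurable_output t)]
    rfl
  have hind : ∀ t, Indep (MeasurableSpace.comap (fun ω => Y t ω d) inferInstance)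
      (beforeOutput D Y t) prob := fun t =>
    indep_of_indep_of_le_left (hrun.indep_output t)
      ((measurable_pi_apply d).comp (comap_measurable (Y t))).comap_le
  have hP : ∀ t, ∀ s ≤ t, MeasurableSet[beforeOutput D Y t] {ω | D s ω = d} := fun t s hs =>
    measurable_design_beforeOutput hs (measurableSet_singleton d)
  have hmap := map_fill_eq_infinitePi (P := fun ω s => D s ω = d) (X := fun t ω => Y t ω d)
    (beforeOutput_le hrun.measurable_design hrun.measurable_output) hP
    (fun t s hs => (measurable_pi_apply d).comp (measurable_output_beforeOutput hs)) hXm hlaw hind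
  have hae := hfam.ae_typicalSample (hθ d)
  rw [← hmap] at hae
  have hprod := ae_of_ae_map (measurable_pi_lambda _ fun j =>
    measurable_fill (P := fun (q : Ω × (ℕ → ℝ)) s => D s q.1 = d)
      (fun s => measurable_fst (hrun.measurable_design s (measurableSet_singleton d)))
      (fun s => (hXm s).comp measurable_fst)
      ((measurable_pi_apply j).comp measurable_snd) j).aemeasurable hae
  filter_upwards [Measure.ae_ae_of_ae_prod hprod] with ω hω
  obtain ⟨w, hw⟩ := hω.exists
  exact ⟨_, hw, fun t ht => fill_count (fun s => D s ω = d) (fun u => Y u ω d) _ t ht⟩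

/-! ### Separating levels of the parameter of interest -/

lemma exists_gt_mem_interior {θ : Param k} (hθ : θ ∈ interior Θ) :
    ∃ θ' ∈ interior Θ, θ.1 < θ'.1 := by
  have hc : Continuous fun r : ℝ => ((r, θ.2) : Param k) := by fun_prop
  have hev : ∀ᶠ r in nhds θ.1, ((r, θ.2) : Param k) ∈ interior Θ :=
    hc.continuousAt.eventually (isOpen_interior.mem_nhds hθ)
  obtain ⟨r, hr, hlt⟩ :=
    ((hev.filter_mono nhdsWithin_le_nhds).and (self_mem_nhdsWithin (s := Set.Ioi θ.1))).exists
  exact ⟨_, hr, hlt⟩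

lemma exists_lt_mem_interior {θ : Param k} (hθ : θ ∈ interior Θ) :
    ∃ θ' ∈ interior Θ, θ'.1 < θ.1 := by
  have hc : Continuous fun r : ℝ => ((r, θ.2) : Param k) := by fun_prop
  have hev : ∀ᶠ r in nhds θ.1, ((r, θ.2) : Param k) ∈ interior Θ :=
    hc.continuousAt.eventually (isOpen_interior.mem_nhds hθ)
  obtain ⟨r, hr, hlt⟩ :=
    ((hev.filter_mono nhdsWithin_le_nhds).and (self_mem_nhdsWithin (s := Set.Iio θ.1))).exists
  exact ⟨_, hr, hlt⟩

/-- There is a level above all true values of the parameter of interest that is still exceeded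
inside the parameter space. -/
lemma exists_upper_level {𝒟 : Type*} [Finite 𝒟] [Nonempty 𝒟] {θstar : 𝒟 → Param k}
    (hθ : ∀ d, θstar d ∈ interior Θ) :
    ∃ a : ℝ, (∀ d, (θstar d).1 < a) ∧ (interior Θ ∩ {θ | a < θ.1}).Nonempty := by
  obtain ⟨d₀, hd₀⟩ := Finite.exists_max fun d => (θstar d).1
  obtain ⟨θ', hθ', hlt⟩ := exists_gt_mem_interior (hθ d₀)
  obtain ⟨a, h1, h2⟩ := exists_between hlt
  exact ⟨a, fun d => (hd₀ d).trans_lt h1, θ', hθ', h2⟩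

lemma exists_lower_level {𝒟 : Type*} [Finite 𝒟] [Nonempty 𝒟] {θstar : 𝒟 → Param k}
    (hθ : ∀ d, θstar d ∈ interior Θ) :
    ∃ b : ℝ, (∀ d, b < (θstar d).1) ∧ (interior Θ ∩ {θ | θ.1 < b}).Nonempty := by
  obtain ⟨d₀, hd₀⟩ := Finite.exists_min fun d => (θstar d).1
  obtain ⟨θ', hθ', hlt⟩ := exists_lt_mem_interior (hθ d₀)
  obtain ⟨b, h1, h2⟩ := exists_between hlt
  exact ⟨b, fun d => h2.trans_le (hd₀ d), θ', hθ', h1⟩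

/-! ### Designs cannot be abandoned -/

section Abandoned

variable {𝒞 𝒟 : Type*} [Fintype 𝒟] [LinearOrder 𝒟] {θstar : 𝒟 → Param k}
  {D : ℕ → 𝒟} {y : ℕ → 𝒟 → ℝ} {x : 𝒟 → ℕ → ℝ} {d : 𝒟}

/-- If `d` is simulated at most `N` times, a product event whose factors for the other designs are
neighborhoods of the true parameters has posterior mass bounded away from zero. -/
lemma exists_le_posterior_pi (hfam : RegularFamily ν Θ p)
    (hx : ∀ d t, D t = d → x d (Nat.count (fun s => D s = d) t) = y t d)
    (hxt : ∀ d, TypicalSample ν Θ p (θstar d) (x d)) (hθ : ∀ d, θstar d ∈ interior Θ) {N : ℕ}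
    (hN : ∀ t, Nat.count (fun s => D s = d) t ≤ N) {U : 𝒟 → Set (Param k)}
    (hU : ∀ d', IsOpen (U d')) (hUd : (interior Θ ∩ U d).Nonempty)
    (hUθ : ∀ d', d' ≠ d → θstar d' ∈ U d') :
    ∃ ε : ℝ, 0 < ε ∧
      ∀ t, ε ≤ (posterior Θ p D (fun s => y s (D s)) t).real (Set.univ.pi U) := by
  have hc : ∀ d', ∃ c : ℝ, 0 < c ∧ ∀ t,
      c * ∫ θ in Θ, seqLik p (x d') (Nat.count (fun s => D s = d') t) θ ≤
        ∫ θ in Θ ∩ U d', seqLik p (x d') (Nat.count (fun s => D s = d') t) θ := by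
    intro d'
    rcases eq_or_ne d' d with rfl | hne
    · obtain ⟨c, hc, h⟩ := (hxt d').exists_mass_of_le hfam (hU d') hUd N
      exact ⟨c, hc, fun t => h _ (hN t)⟩
    · obtain ⟨c, hc, h⟩ := (hxt d').exists_mass hfam (hθ d') (hU d') (hUθ d' hne)
      exact ⟨c, hc, fun t => h _⟩
  choose c hc hcU using hc
  exact ⟨∏ d', c d', Finset.prod_pos fun d' _ => hc d', fun t =>
    le_posterior_pi hfam hx hxt hθ t (fun d' => (hU d').measurableSet) (fun d' => (hc d').le)
      fun d' => hcU d' t⟩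

/-- If `d` is simulated only boundedly often, the algorithm selects it at every step with a
probability that is bounded away from zero. -/
lemma exists_le_topTwoPolicy [Fintype 𝒞] {ctx : 𝒟 → 𝒞} {m : 𝒞 → ℕ}
    (hm : ∀ c, 1 ≤ m c ∧ m c < Nat.card {d : 𝒟 // ctx d = c}) (hfam : RegularFamily ν Θ p)
    (hx : ∀ d t, D t = d → x d (Nat.count (fun s => D s = d) t) = y t d)
    (hxt : ∀ d, TypicalSample ν Θ p (θstar d) (x d)) (hθ : ∀ d, θstar d ∈ interior Θ) {N : ℕ}
    (hN : ∀ t, Nat.count (fun s => D s = d) t ≤ N) {γ : ℕ → 𝒞 → ℝ}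
    (hγ : ∀ t c, γ t c ∈ Set.Ioo (0 : ℝ) 1) :
    ∃ ε : ℝ, 0 < ε ∧ ∀ t, ε ≤
      topTwoPolicy ctx m (posterior Θ p D (fun s => y s (D s)) t) (γ t) d := by
  have : Nonempty 𝒟 := ⟨d⟩
  have : Nonempty 𝒞 := ⟨ctx d⟩
  obtain ⟨a, ha, hane⟩ := exists_upper_level hθ
  obtain ⟨b, hb, hbne⟩ := exists_lower_level hθ
  have hgt : ∀ r : ℝ, IsOpen {θ : Param k | r < θ.1} := fun r =>
    isOpen_lt continuous_const continuous_fst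
  have hlt : ∀ r : ℝ, IsOpen {θ : Param k | θ.1 < r} := fun r =>
    isOpen_lt continuous_fst continuous_const
  -- On `pi U` the sampled `μ_d` is the largest of all designs, on `pi V` it is the smallest.
  set U : 𝒟 → Set (Param k) := fun d' => if d' = d then {θ | a < θ.1} else {θ | θ.1 < a} with hUdef
  set V : 𝒟 → Set (Param k) := fun d' => if d' = d then {θ | θ.1 < b} else {θ | b < θ.1} with hVdef
  have hU : ∀ d', IsOpen (U d') := fun d' => by
    simp only [hUdef]; split_ifs
    exacts [hgt a, hlt a]
  have hV : ∀ d', IsOpen (V d') := fun d' => by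
    simp only [hVdef]; split_ifs
    exacts [hlt b, hgt b]
  obtain ⟨ε₁, hε₁, h₁⟩ := exists_le_posterior_pi (d := d) hfam hx hxt hθ hN hU
    (by simpa [hUdef] using hane) (fun d' hne => by simpa [hUdef, hne] using ha d')
  obtain ⟨ε₂, hε₂, h₂⟩ := exists_le_posterior_pi (d := d) hfam hx hxt hθ hN hV
    (by simpa [hVdef] using hbne) (fun d' hne => by simpa [hVdef, hne] using hb d')
  have hcard : (0 : ℝ) < ((Fintype.card 𝒞 * Fintype.card 𝒟 : ℕ) : ℝ)⁻¹ :=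
    inv_pos.2 (Nat.cast_pos.2 (Nat.mul_pos Fintype.card_pos Fintype.card_pos))
  refine ⟨((Fintype.card 𝒞 * Fintype.card 𝒟 : ℕ) : ℝ)⁻¹ * (ε₁ * ε₂), by positivity, fun t => ?_⟩
  have := isProbabilityMeasure_posterior hfam hx hxt hθ t
  refine (mul_le_mul_of_nonneg_left (mul_le_mul (h₁ t) (h₂ t) hε₂.le measureReal_nonneg)
    hcard.le).trans (le_topTwoPolicy (hγ t)
      (MeasurableSet.univ_pi fun d' => (hU d').measurableSet)
      (MeasurableSet.univ_pi fun d' => (hV d').measurableSet) ?_ ?_)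
  · intro θ hθU
    refine mem_topSet_of_forall_lt (hm _).1 fun d' hne => ?_
    have h1 : (θ d').1 < a := by simpa [hUdef, hne] using hθU d' (Set.mem_univ _)
    have h2 : a < (θ d).1 := by simpa [hUdef] using hθU d (Set.mem_univ _)
    exact h1.trans h2
  · intro θ hθV
    refine notMem_topSet_of_forall_lt (hm _).2 fun d' hne => ?_
    have h1 : b < (θ d').1 := by simpa [hVdef, hne] using hθV d' (Set.mem_univ _)
    have h2 : (θ d).1 < b := by simpa [hVdef] using hθV d (Set.mem_univ _)
    exact h2.trans h1

end Abandoned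

end TTTSC

theorem theorem3 {k : ℕ} {𝒞 𝒟 Ω : Type*} [Fintype 𝒞] [Fintype 𝒟] [LinearOrder 𝒟]
    [MeasurableSpace 𝒟] [DiscreteMeasurableSpace 𝒟]
    [MeasurableSpace Ω] (prob : Measure Ω) [IsProbabilityMeasure prob]
    (ν : Measure ℝ) (Θ : Set (TTTSC.Param k)) (p : TTTSC.Param k → ℝ → ℝ)
    (hfam : TTTSC.RegularFamily ν Θ p)
    (θstar : 𝒟 → TTTSC.Param k) (hθ : ∀ d, θstar d ∈ interior Θ)
    (ctx : 𝒟 → 𝒞) (m : 𝒞 → ℕ)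
    (hm : ∀ c, 1 ≤ m c ∧ m c < Nat.card {d : 𝒟 // ctx d = c})
    (γ : ℕ → Ω → 𝒞 → ℝ) (D : ℕ → Ω → 𝒟) (Y : ℕ → Ω → 𝒟 → ℝ)
    (hrun : TTTSC.IsTopTwoRun prob ν Θ p θstar ctx m γ D Y) :
    ∀ᵐ ω ∂prob, ∀ c : 𝒞, ∀ d : 𝒟, ctx d = c →
      Tendsto (fun T : ℕ => ∑ t ∈ Finset.range T, if D t ω = d then 1 else 0) atTop
        (atTop : Filter ℕ) := by
  have htyp := ae_all_iff.2 (hrun.ae_exists_typicalSample hfam fun d => interior_subset (hθ d))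
  -- Shifting by one step makes the choice made at step `n` known at time `n + 1`.
  have hlevy := ae_all_iff.2 fun d => ae_mem_limsup_atTop_iff prob
    (ℱ := TTTSC.observedFiltration hrun.measurable_design hrun.measurable_output)
    (s := fun n => {ω | ∃ t, n = t + 1 ∧ D t ω = d}) (by
      rintro (_ | n)
      · simp
      · have h : {ω | ∃ t, n + 1 = t + 1 ∧ D t ω = d} = {ω | D n ω = d} := by ext; simp
        rw [h]
        exact TTTSC.measurable_design_observed n (measurableSet_singleton d))
  have hpol := ae_all_iff.2 fun t => ae_all_iff.2 (hrun.condProb_design t)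
  filter_upwards [htyp, hlevy, hpol] with ω hx hlevy hpol c d _
  choose x hxt hx using hx
  have hsum : ∀ T, ∑ t ∈ Finset.range T, (if D t ω = d then 1 else 0) =
      Nat.count (fun s => D s ω = d) T := fun T => by
    rw [Nat.count_eq_card_filter_range, Finset.card_filter]
  simp_rw [hsum]
  refine tendsto_atTop_atTop_of_monotone (Nat.count_monotone _) ?_
  by_contra! hbdd
  obtain ⟨N, hN⟩ := hbdd
  obtain ⟨ε, hε, hle⟩ := TTTSC.exists_le_topTwoPolicy (d := d) (y := fun s => Y s ω) hm hfam hx hxt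
    hθ (fun t => (hN t).le) fun t c => hrun.gamma_mem t ω c
  have hcond : Tendsto (fun n => ∑ t ∈ Finset.range n,
      (prob[({ω | ∃ t', t + 1 = t' + 1 ∧ D t' ω = d}).indicator (1 : Ω → ℝ) |
        TTTSC.observedFiltration hrun.measurable_design hrun.measurable_output t]) ω)
      atTop atTop := by
    refine tendsto_atTop_mono (f := fun n : ℕ => n * ε) (fun n => ?_)
      (tendsto_natCast_atTop_atTop.atTop_mul_const hε)
    rw [← nsmul_eq_mul, ← Finset.card_range n, ← Finset.sum_const, Finset.card_range]
    refine Finset.sum_le_sum fun t _ => (hle t).trans (le_of_eq ?_)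
    have h : {ω | ∃ t', t + 1 = t' + 1 ∧ D t' ω = d} = {ω | D t ω = d} := by ext; simp
    rw [h]
    exact (hpol t d).symm
  have hmem := (hlevy d).2 hcond
  rw [mem_limsup_iff_frequently_mem] at hmem
  have hinf : {t | D t ω = d}.Infinite := by
    refine Nat.frequently_atTop_iff_infinite.1 (frequently_atTop.2 fun n => ?_)
    obtain ⟨_, hn, t, rfl, ht⟩ := frequently_atTop.1 hmem (n + 1)
    exact ⟨t, by omega, ht⟩
  obtain ⟨n, hn⟩ := Nat.surjective_count_of_infinite_setOfPred hinf N
  exact (hN n).ne hn
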